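/- **Setting.** Let $A$ be a unital $C^*$-algebra with a strongly continuous action $\sigma$ of the unit circle $S^1$ by $*$-automorphisms. For $n\in\mathbb Z$ put $A_n=\{a\in A:\sigma_\lambda(a)=\lambda^n a \text{ for all }\lambda\in S^1\}$, and let $P_0:A\to A_0$, $P_0(a)=\frac1{2\pi}\int_0^{2\pi}\sigma_{e^{it}}(a)\,dt$. Let $\mathcal A\subseteq A$ be a norm-dense unital $*$-subalgebra which is generated as a $*$-algebra by $\mathcal A\cap A_1$, and put $\mathcal A_n=\mathcal A\cap A_n$. *Twisted Lipschitz triples.* Let $D$ be a selfadjoint unbounded operator on a separable Hilbert space $K$, let $(V_s)_{s\in\mathbb R}$ be a strongly continuous one-parameter group of unitaries on $K$ and $\beta_s(T)=V_sTV_s^*$. For $r\in\mathbb R$, a bounded operator $T$ is analytic of order $r$ if $s\mapsto\beta_s(T)$ extends to a norm continuous map $z\mapsto \beta_z(T)$ on the closed strip of all $z$ with $\operatorname{Im} z$ between $0$ and $r$, holomorphic in the interior. $T$ is twisted Lipschitz if $T$ and $T^*$ are analytic of order $1$, $\beta_i(T)$ preserves $\operatorname{Dom}(D)$ and $D\beta_i(T)-\beta_{-i}(T)D$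 extends from $\operatorname{Dom}(D)$ to a bounded operator $\delta_\beta(T)$ on $K$. Given a unital $C^*$-algebra $B$ with an injective unital $*$-homomorphism $\pi:B\to\mathbb L(K)$ and a norm-dense unital $*$-subalgebra $\mathcal B\subseteq B$, $(\mathcal B,K,D)$ is a twisted Lipschitz triple on $B$ (with respect to $(V_s)$) if $\pi(b)$ is twisted Lipschitz for all $b\in\mathcal B$; the associated twisted $*$-derivation is $b\mapsto\delta_\beta(\pi(b))$. If $V_s=1$ for all $s$ it is called a Lipschitz triple. A grading operator is a selfadjoint unitary $\gamma$ on $K$ with $\gamma\pi(b)=\pi(b)\gamma$ for $b\in B$, $\gamma V_s=V_s\gamma$ for $s\in\mathbb R$ and $\gamma D=-D\gamma$. Let $(\mathcal A_0,H_0,D_0)$ be a Lipschitz triple on $A_0$ with representation $\rho$ and derivation $\delta_0(a)=\overline{[D_0,\rho(a)]}$. Assume that we are given a separable Hilbert space $H$ containing $H_0$ as a closed subspace, a unital $*$-homomorphism $\phi:A\to\mathbb L(H)$, a linear map $\delta:\mathcal A\to\mathbb L(H)$ and a constant $\mu>0$ such that 1. $\delta(a)\xi=\delta_0(a)\xi$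 and $\phi(a)\xi=\rho(a)\xi$ for all $a\in\mathcal A_0$, $\xi\in H_0$; 2. $\delta(ab)=\delta(a)\phi(b)+\mu^n\phi(a)\delta(b)$ for all $n\in\mathbb Z$, $a\in\mathcal A_n$, $b\in\mathcal A$; 3. there are finitely many $\zeta^R_j,\zeta^L_j\in\mathcal A_1$ with $\sum_j\zeta^R_j(\zeta^R_j)^*=1=\sum_j(\zeta^L_j)^*\zeta^L_j$ and $\sum_j\phi(\zeta^R_j)\delta((\zeta^R_j)^*)=0=\sum_j\phi(\zeta^L_j)^*\delta(\zeta^L_j)$. **Modular lift.** Let $X$ be the Hilbert $C^*$-module over $A_0$ obtained by completing $A$ for the inner product $\langle a,b\rangle=P_0(a^*b)$, and let $G=X\widehat\otimes_\rho H_0$, so that $\langle a\otimes\xi,b\otimes\eta\rangle=\langle\xi,\rho(P_0(a^*b))\eta\rangle$; $A$ acts on $G$ by $a\cdot(b\otimes\xi)=ab\otimes\xi$. Let $G_n\subseteq G$ be the closed linear span of all $x\otimes\xi$ with $x\in A_n$, $\xi\in H_0$. Let $V_s(\mu)$ be the one-parameter group of unitaries on $G$ acting as $\mu^{isn/2}$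 on $G_n$, and $\Gamma=V_{-i}(\mu)$ the positive invertible selfadjoint operator acting as $\mu^{n/2}$ on $G_n$ ($n\in\mathbb Z$). For every $n$ choose a finite frame $(\zeta_{n,j})_j$ of $\mathcal A_n$, i.e. finitely many elements of $\mathcal A_n$ with $\sum_j\zeta_{n,j}\zeta_{n,j}^*x=x$ for $x\in\mathcal A_n$, such that $\sum_j\phi(\zeta_{n,j})\delta(\zeta_{n,j}^*)=0$. The corresponding Grassmann connections $\nabla(x)\xi=\sum_j\zeta_{n,j}\otimes\delta_0(\zeta_{n,j}^*x)\xi$ $(x\in\mathcal A_n)$ define the horizontal lift $(1\otimes_\nabla D_0)(x\otimes\xi)=\nabla(x)\xi+x\otimes D_0\xi$ on the linear span of all $x\otimes\xi$ with $x\in\mathcal A_n$, $n\in\mathbb Z$, $\xi\in\operatorname{Dom}(D_0)$. The modular lift $D_\Gamma$ is the closure of $\Gamma^2(1\otimes_\nabla D_0)$. **Theorem.** Frames as required exist for every $n\in\mathbb Z$, and there are isometries $U_n:G_n\to H$ with $U_n(x\otimes\xi)=\phi(x)\xi$ for $x\in A_n$, $\xi\in H_0$. For every choice of such frames, the closure $D_\Gamma$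 is a well-defined operator and $(\mathcal A,G,D_\Gamma)$ is a twisted Lipschitz triple on $A$ with respect to $(V_s(\mu))_{s\in\mathbb R}$ (in particular, $G$ is separable, $D_\Gamma$ is selfadjoint and $A$ acts faithfully on $G$). The associated map $\delta_\Gamma:\mathcal A\to\mathbb L(G)$ is a twisted $*$-derivation, i.e. it is linear with $\delta_\Gamma(ab)=\delta_\Gamma(a)\beta_i(b)+\beta_{-i}(a)\delta_\Gamma(b)$ and $\delta_\Gamma(a^*)=-\delta_\Gamma(a)^*$, and for all $n,m\in\mathbb Z$, $a\in\mathcal A_n$ and $\eta\in G_m$ one has $\delta_\Gamma(a)\eta\in G_{n+m}$ and $$U_{n+m}\,\delta_\Gamma(a)\eta=\mu^{-n/2}\,\delta(a)\,U_m\eta .$$ If $\gamma_0$ is a grading operator for $(\mathcal A_0,H_0,D_0)$, then $1\widehat\otimes\gamma_0$ (the operator $x\otimes\xi\mapsto x\otimes\gamma_0\xi$ on $G$) is a grading operator for $(\mathcal A,G,D_\Gamma)$. -/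

import Mathlib

open scoped TensorProduct InnerProductSpace
open MeasureTheory

namespace ModularLift

/-- A strongly continuous action of the unit circle on a unital C*-algebra by *-automorphisms. -/
structure CircleAction (A : Type*) [CStarAlgebra A] where
  /-- the action, as a group homomorphism into the *-automorphisms -/
  toHom : Circle →* (A ≃⋆ₐ[ℂ] A)
  /-- strong continuity -/
  continuous_apply : ∀ a : A, Continuous fun z : Circle => toHom z a

namespace CircleAction

variable {A : Type*} [CStarAlgebra A] (σ : CircleAction A)

/-- Each automorphism of the action is a bounded operator. -/
noncomputable def actCLM (z : Circle) : A →L[ℂ] A where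
  toLinearMap := (σ.toHom z : A →⋆ₐ[ℂ] A).toAlgHom.toLinearMap
  cont := (NonUnitalStarAlgHom.isometry _ (EquivLike.injective (σ.toHom z))).continuous

@[simp] theorem actCLM_apply (z : Circle) (a : A) : σ.actCLM z a = σ.toHom z a := rfl

/-- The spectral subspace `A_n = {a | σ_z(a) = z ^ n a for all z in the circle}`. -/
def spectralSubspace (n : ℤ) : Submodule ℂ A where
  carrier := {a | ∀ z : Circle, σ.toHom z a = ((z : ℂ) ^ n) • a}
  add_mem' {a b} ha hb z := by rw [map_add, ha z, hb z, smul_add]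
  zero_mem' z := by rw [map_zero, smul_zero]
  smul_mem' c a ha z := by rw [map_smul, ha z, smul_comm]

/-- The fixed point algebra `A_0` as a unital *-subalgebra of `A`. -/
def fixedAlgebra : StarSubalgebra ℂ A where
  carrier := {a | ∀ z : Circle, σ.toHom z a = a}
  mul_mem' {a b} ha hb z := by rw [map_mul, ha z, hb z]
  add_mem' {a b} ha hb z := by rw [map_add, ha z, hb z]
  algebraMap_mem' c z := by rw [Algebra.algebraMap_eq_smul_one, map_smul, map_one]
  star_mem' {a} ha z := by rw [map_star, ha z]

theorem isClosed_fixedAlgebra : IsClosed (σ.fixedAlgebra : Set A) := by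
  have h : (σ.fixedAlgebra : Set A) = ⋂ z : Circle, {a | σ.toHom z a = a} := by
    ext a; simp [fixedAlgebra]
  rw [h]
  exact isClosed_iInter fun z => isClosed_eq (σ.actCLM z).continuous continuous_id

instance : IsClosed (σ.fixedAlgebra : Set A) := σ.isClosed_fixedAlgebra

/-- The spectral projection `P_0 (a) = (1 / 2π) ∫_0^{2π} σ_{exp(it)}(a) dt`. -/
noncomputable def condExp (a : A) : A :=
  ((2 * Real.pi)⁻¹ : ℝ) • ∫ t in (0 : ℝ)..(2 * Real.pi), σ.toHom (Circle.exp t) a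


theorem continuous_orbit (a : A) : Continuous fun t : ℝ => σ.toHom (Circle.exp t) a :=
  (σ.continuous_apply a).comp Circle.exp.continuous

theorem intervalIntegrable_orbit (a : A) (s t : ℝ) :
    IntervalIntegrable (fun t : ℝ => σ.toHom (Circle.exp t) a) volume s t :=
  (σ.continuous_orbit a).intervalIntegrable s t

theorem condExp_add (a b : A) : σ.condExp (a + b) = σ.condExp a + σ.condExp b := by
  simp only [condExp, map_add]
  rw [intervalIntegral.integral_add (σ.intervalIntegrable_orbit a _ _)
    (σ.intervalIntegrable_orbit b _ _), smul_add]

theorem condExp_smul (c : ℂ) (a : A) : σ.condExp (c • a) = c • σ.condExp a := by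
  simp only [condExp, map_smul]
  rw [intervalIntegral.integral_smul, smul_comm]

theorem condExp_star (a : A) : σ.condExp (star a) = star (σ.condExp a) := by
  simp only [condExp, map_star]
  have h := ((starL' ℝ : A ≃L[ℝ] A) : A →L[ℝ] A).intervalIntegral_comp_comm
    (σ.intervalIntegrable_orbit a 0 (2 * Real.pi))
  simp only [ContinuousLinearEquiv.coe_coe, starL'_apply] at h
  rw [h]
  exact (((starL' ℝ : A ≃L[ℝ] A) : A →L[ℝ] A).map_smul (2 * Real.pi)⁻¹ _).symm

theorem act_condExp (z : Circle) (a : A) : σ.toHom z (σ.condExp a) = σ.condExp (σ.toHom z a) := by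
  have h := (σ.actCLM z).intervalIntegral_comp_comm
    (σ.intervalIntegrable_orbit a 0 (2 * Real.pi))
  simp only [actCLM_apply] at h
  have h2 : ∀ t : ℝ, σ.toHom z (σ.toHom (Circle.exp t) a)
      = σ.toHom (Circle.exp t) (σ.toHom z a) := by
    intro t
    rw [← StarAlgEquiv.mul_apply, ← StarAlgEquiv.mul_apply, ← map_mul, ← map_mul, mul_comm]
  simp only [h2] at h
  have h3 : ∀ (r : ℝ) (x : A), σ.toHom z (r • x) = r • σ.toHom z x := fun r x =>
    ((σ.actCLM z).restrictScalars ℝ).map_smul r x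
  rw [condExp, condExp, h3, h]

theorem condExp_act (z : Circle) (a : A) : σ.condExp (σ.toHom z a) = σ.condExp a := by
  obtain ⟨s, rfl⟩ : ∃ s : ℝ, Circle.exp s = z := ⟨Complex.arg z, Circle.exp_arg z⟩
  have h : ∀ t : ℝ, σ.toHom (Circle.exp t) (σ.toHom (Circle.exp s) a)
      = σ.toHom (Circle.exp (t + s)) a := by
    intro t
    rw [Circle.exp_add, map_mul, StarAlgEquiv.mul_apply]
  have hp : Function.Periodic (fun t : ℝ => σ.toHom (Circle.exp t) a) (2 * Real.pi) := by
    intro t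
    simp [Circle.exp_add, Circle.exp_two_pi]
  rw [condExp, condExp]
  simp only [h]
  rw [intervalIntegral.integral_comp_add_right (fun t : ℝ => σ.toHom (Circle.exp t) a)]
  congr 1
  have := hp.intervalIntegral_add_eq s 0
  simpa [add_comm] using this

theorem condExp_mem (a : A) : σ.condExp a ∈ σ.fixedAlgebra := fun z => by
  rw [act_condExp, condExp_act]

/-- The spectral projection onto the fixed point algebra, as a linear map `P_0 : A → A_0`. -/
noncomputable def condExpₗ : A →ₗ[ℂ] σ.fixedAlgebra where
  toFun a := ⟨σ.condExp a, σ.condExp_mem a⟩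
  map_add' a b := Subtype.ext (σ.condExp_add a b)
  map_smul' c a := Subtype.ext (σ.condExp_smul c a)

theorem coe_condExpₗ (a : A) : (σ.condExpₗ a : A) = σ.condExp a := rfl

theorem condExpₗ_star (a : A) : σ.condExpₗ (star a) = star (σ.condExpₗ a) :=
  Subtype.ext (σ.condExp_star a)

theorem condExpₗ_act (z : Circle) (a : A) : σ.condExpₗ (σ.toHom z a) = σ.condExpₗ a :=
  Subtype.ext (σ.condExp_act z a)

/-- An average of squares is a square `S^* S`, where `S` is fixed by each *-homomorphism which
fixes the average. -/
theorem exists_star_mul_self_eq_integral {B : Type*} [CStarAlgebra B] [PartialOrder B]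
    [StarOrderedRing B] (F : ℝ → B) (hF : Continuous F) (hpos : ∀ t, ∃ c, F t = star c * c) :
    ∃ S : B,
      (∀ e : B →L[ℂ] A, e (star S * S) =
        ((2 * Real.pi)⁻¹ : ℝ) • ∫ t in (0 : ℝ)..(2 * Real.pi), e (F t)) ∧
      ∀ f : B →⋆ₙₐ[ℂ] B, f (star S * S) = star S * S → f S = S := by
  set M : B := ((2 * Real.pi)⁻¹ : ℝ) • ∫ t in (0 : ℝ)..(2 * Real.pi), F t
  have hM0 : 0 ≤ M := by
    refine smul_nonneg (by positivity) ?_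
    rw [intervalIntegral.integral_of_le (by positivity)]
    refine integral_nonneg fun t => ?_
    obtain ⟨c, hc⟩ := hpos t
    rw [hc]
    exact star_mul_self_nonneg _
  have hs : star (CFC.sqrt M) * CFC.sqrt M = M := by
    rw [(CFC.sqrt_nonneg M).isSelfAdjoint.star_eq, CFC.sqrt_mul_sqrt_self M hM0]
  refine ⟨CFC.sqrt M, fun e => ?_, fun f hf => ?_⟩
  · rw [hs, e.intervalIntegral_comp_comm (hF.intervalIntegrable (μ := volume) _ _)]
    exact (e.restrictScalars ℝ).map_smul _ _
  rw [hs] at hf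
  symm
  refine CFC.sqrt_unique ?_ ?_
  · rw [← map_mul, CFC.sqrt_mul_sqrt_self M hM0, hf]
  · obtain ⟨c, hc⟩ := CStarAlgebra.nonneg_iff_eq_star_mul_self.mp (CFC.sqrt_nonneg M)
    rw [hc, map_mul, map_star]
    exact star_mul_self_nonneg _

/-- Positivity of the matrix `P_0 (a_i^* a_j)`: it factorizes through matrices over `A_0`. -/
theorem exists_gram {ι : Type*} [Fintype ι] [DecidableEq ι] (a : ι → A) :
    ∃ B : ι → ι → σ.fixedAlgebra,
      ∀ i j, σ.condExpₗ (star (a i) * a j) = ∑ k, star (B k i) * B k j := by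
  let _ : PartialOrder A := CStarAlgebra.spectralOrder A
  have _ : StarOrderedRing A := CStarAlgebra.spectralOrderedRing A
  rcases isEmpty_or_nonempty ι with hι | ⟨⟨k₀⟩⟩
  · exact ⟨fun i => (hι.false i).elim, fun i => (hι.false i).elim⟩
  let R : CStarMatrix ι ι A := CStarMatrix.ofMatrix (Matrix.of fun k j => if k = k₀ then a j else 0)
  let F : ℝ → CStarMatrix ι ι A := fun t =>
    CStarMatrix.mapₙₐ ((σ.toHom (Circle.exp t) : A →⋆ₐ[ℂ] A) : A →⋆ₙₐ[ℂ] A) (star R * R)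
  have hR : ∀ i j, (star R * R) i j = star (a i) * a j := by
    intro i j
    rw [CStarMatrix.mul_apply]
    simp [R, CStarMatrix.star_apply]
  have hF : ∀ t i j, F t i j = σ.toHom (Circle.exp t) (star (a i) * a j) := by
    intro t i j
    rw [← hR]; rfl
  have hcont : Continuous F := by
    have hM : Continuous fun t i j => F t i j :=
      continuous_pi fun i => continuous_pi fun j => by
        simp only [hF]; exact σ.continuous_orbit _
    exact (CStarMatrix.ofMatrixL (m := ι) (n := ι) (A := A)).continuous.comp hM
  obtain ⟨S, hS, hfix⟩ := exists_star_mul_self_eq_integral (A := A) F hcont (fun t => by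
    refine ⟨CStarMatrix.mapₙₐ ((σ.toHom (Circle.exp t) : A →⋆ₐ[ℂ] A) : A →⋆ₙₐ[ℂ] A) R, ?_⟩
    simp only [F, map_mul, map_star])
  have hij : ∀ i j, (star S * S) i j = σ.condExp (star (a i) * a j) := by
    intro i j
    let e : CStarMatrix ι ι A →L[ℂ] A :=
      (ContinuousLinearMap.proj (R := ℂ) j ∘L ContinuousLinearMap.proj (R := ℂ) i) ∘L
        (CStarMatrix.ofMatrixL (m := ι) (n := ι) (A := A)).symm.toContinuousLinearMap
    have h4 : e (star S * S) = σ.condExp (star (a i) * a j) := by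
      have h5 : ∀ t, e (F t) = σ.toHom (Circle.exp t) (star (a i) * a j) := fun t => hF t i j
      rw [hS]
      simp only [h5]
      rfl
    exact h4
  have hfixS : ∀ z k j, σ.toHom z (S k j) = S k j := by
    intro z k j
    have := hfix (CStarMatrix.mapₙₐ (n := ι) ((σ.toHom z : A →⋆ₐ[ℂ] A) : A →⋆ₙₐ[ℂ] A)) (by
      ext i j
      change σ.toHom z ((star S * S) i j) = (star S * S) i j
      rw [hij]
      exact σ.condExp_mem _ z)
    exact congrFun (congrFun this k) j
  refine ⟨fun k j => ⟨S k j, fun z => hfixS z k j⟩, fun i j => ?_⟩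
  apply Subtype.ext
  rw [coe_condExpₗ, ← hij, CStarMatrix.mul_apply]
  simp [CStarMatrix.star_apply]

end CircleAction

section Tensor

variable {A : Type*} [CStarAlgebra A] (σ : CircleAction A)
variable {H₀ : Type*} [NormedAddCommGroup H₀] [InnerProductSpace ℂ H₀] [CompleteSpace H₀]
variable (ρ : σ.fixedAlgebra →⋆ₐ[ℂ] (H₀ →L[ℂ] H₀))

/-- The sesquilinear map `(a, b) ↦ ρ (P_0 (a^* b))`. -/
noncomputable def kernel : A →ₗ⋆[ℂ] A →ₗ[ℂ] (H₀ →L[ℂ] H₀) :=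
  LinearMap.mk₂'ₛₗ (starRingEnd ℂ) (RingHom.id ℂ) (fun a b => ρ (σ.condExpₗ (star a * b)))
    (fun a a' b => by simp [add_mul])
    (fun c a b => by simp)
    (fun a b b' => by simp [mul_add])
    (fun c a b => by simp)

theorem kernel_apply (a b : A) : kernel σ ρ a b = ρ (σ.condExpₗ (star a * b)) := rfl

theorem inner_kernel_left (a b : A) (ξ η : H₀) :
    ⟪ρ (σ.condExpₗ (star a * b)) ξ, η⟫_ℂ = ⟪ξ, ρ (σ.condExpₗ (star b * a)) η⟫_ℂ := by
  have h : star b * a = star (star a * b) := by simp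
  rw [h, σ.condExpₗ_star, map_star, ContinuousLinearMap.star_eq_adjoint,
    ContinuousLinearMap.adjoint_inner_right]

/-- The linear functional `⟪a ⊗ ξ, · ⟫` on `A ⊗ H₀`. -/
noncomputable def functional (a : A) (ξ : H₀) : A ⊗[ℂ] H₀ →ₗ[ℂ] ℂ :=
  TensorProduct.lift (LinearMap.mk₂ ℂ (fun b η => ⟪ξ, kernel σ ρ a b η⟫_ℂ)
    (fun b b' η => by simp only [map_add, add_apply, inner_add_right])
    (fun c b η => by simp only [map_smul, smul_apply, inner_smul_right, smul_eq_mul])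
    (fun b η η' => by simp only [map_add, inner_add_right])
    (fun c b η => by simp only [map_smul, inner_smul_right, smul_eq_mul]))

theorem functional_tmul (a b : A) (ξ η : H₀) :
    functional σ ρ a ξ (b ⊗ₜ η) = ⟪ξ, kernel σ ρ a b η⟫_ℂ := rfl

/-- The semi-inner product `⟪a ⊗ ξ, b ⊗ η⟫ = ⟪ξ, ρ (P_0 (a^* b)) η⟫` on `A ⊗ H₀`, as a
sesquilinear map. -/
noncomputable def form : A ⊗[ℂ] H₀ →ₗ⋆[ℂ] (A ⊗[ℂ] H₀ →ₗ[ℂ] ℂ) :=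
  TensorProduct.lift (LinearMap.mk₂'ₛₗ (starRingEnd ℂ) (starRingEnd ℂ)
    (fun a ξ => functional σ ρ a ξ)
    (fun a a' ξ => TensorProduct.ext' fun b η => by
      simp only [functional_tmul, map_add, LinearMap.add_apply, add_apply, inner_add_right])
    (fun c a ξ => TensorProduct.ext' fun b η => by
      simp only [functional_tmul, LinearMap.map_smulₛₗ, LinearMap.smul_apply, smul_apply,
        inner_smul_right, smul_eq_mul])
    (fun a ξ ξ' => TensorProduct.ext' fun b η => by
      simp only [functional_tmul, LinearMap.add_apply, inner_add_left])
    (fun c a ξ => TensorProduct.ext' fun b η => by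
      simp only [functional_tmul, LinearMap.smul_apply, inner_smul_left, smul_eq_mul]))

theorem form_tmul (a b : A) (ξ η : H₀) :
    form σ ρ (a ⊗ₜ ξ) (b ⊗ₜ η) = ⟪ξ, ρ (σ.condExpₗ (star a * b)) η⟫_ℂ := rfl

theorem form_conj_symm (x y : A ⊗[ℂ] H₀) : starRingEnd ℂ (form σ ρ y x) = form σ ρ x y := by
  induction x with
  | zero => simp
  | add x x' hx hx' => simp [hx, hx']
  | tmul a ξ =>
    induction y with
    | zero => simp
    | add y y' hy hy' => simp [hy, hy']
    | tmul b η => rw [form_tmul, form_tmul, inner_conj_symm, inner_kernel_left]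

theorem form_self_nonneg (x : A ⊗[ℂ] H₀) : 0 ≤ (form σ ρ x x).re := by
  classical
  obtain ⟨s, rfl⟩ := TensorProduct.exists_finset x
  rw [← Finset.sum_coe_sort s (fun i : A × H₀ => i.1 ⊗ₜ[ℂ] i.2)]
  obtain ⟨B, hB⟩ := σ.exists_gram (fun i : s => (i : A × H₀).1)
  have h1 : ∀ i j : s, ⟪(i : A × H₀).2,
      ρ (σ.condExpₗ (star (i : A × H₀).1 * (j : A × H₀).1)) (j : A × H₀).2⟫_ℂ
      = ∑ k : s, ⟪ρ (B k i) (i : A × H₀).2, ρ (B k j) (j : A × H₀).2⟫_ℂ := by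
    intro i j
    rw [hB, map_sum, sum_apply, inner_sum]
    refine Finset.sum_congr rfl fun k _ => ?_
    rw [map_mul, map_star, ContinuousLinearMap.star_eq_adjoint, mul_apply_eq_comp,
      ContinuousLinearMap.adjoint_inner_right]
  have h : form σ ρ (∑ i : s, (i : A × H₀).1 ⊗ₜ[ℂ] (i : A × H₀).2)
      (∑ i : s, (i : A × H₀).1 ⊗ₜ[ℂ] (i : A × H₀).2)
      = ∑ k : s, ⟪∑ i : s, ρ (B k i) (i : A × H₀).2, ∑ i : s, ρ (B k i) (i : A × H₀).2⟫_ℂ := by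
    simp only [map_sum, LinearMap.sum_apply, form_tmul, h1, inner_sum, sum_inner]
    rw [Finset.sum_comm_cycle]
  rw [h, Complex.re_sum]
  exact Finset.sum_nonneg fun k _ => inner_self_nonneg (𝕜 := ℂ)

/-- The algebraic tensor product `A ⊗ H₀`, equipped with the semi-inner product
`⟪a ⊗ ξ, b ⊗ η⟫ = ⟪ξ, ρ (P_0 (a^* b)) η⟫`. -/
@[nolint unusedArguments]
def PreTensor (_ : σ.fixedAlgebra →⋆ₐ[ℂ] (H₀ →L[ℂ] H₀)) : Type _ := A ⊗[ℂ] H₀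

noncomputable instance : AddCommGroup (PreTensor σ ρ) := inferInstanceAs (AddCommGroup (A ⊗[ℂ] H₀))
noncomputable instance : Module ℂ (PreTensor σ ρ) := inferInstanceAs (Module ℂ (A ⊗[ℂ] H₀))

/-- The identity map from `A ⊗ H₀` to the type carrying the semi-inner product. -/
noncomputable def toPre : A ⊗[ℂ] H₀ ≃ₗ[ℂ] PreTensor σ ρ := LinearEquiv.refl ℂ _

/-- The semi-inner product space structure on `A ⊗ H₀`. -/
noncomputable abbrev preCore : PreInnerProductSpace.Core ℂ (PreTensor σ ρ) where
  inner x y := form σ ρ ((toPre σ ρ).symm x) ((toPre σ ρ).symm y)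
  conj_inner_symm x y := form_conj_symm σ ρ _ _
  re_inner_nonneg x := form_self_nonneg σ ρ _
  add_left x y z := by rw [map_add, map_add, LinearMap.add_apply]
  smul_left x y c := by rw [map_smul, LinearMap.map_smulₛₗ, LinearMap.smul_apply, smul_eq_mul]

noncomputable instance : SeminormedAddCommGroup (PreTensor σ ρ) :=
  InnerProductSpace.Core.toSeminormedAddCommGroup (c := preCore σ ρ)

noncomputable instance : InnerProductSpace ℂ (PreTensor σ ρ) :=
  InnerProductSpace.ofCore (preCore σ ρ)

theorem inner_toPre (x y : A ⊗[ℂ] H₀) : ⟪toPre σ ρ x, toPre σ ρ y⟫_ℂ = form σ ρ x y := rfl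

theorem norm_toPre_sq (x : A ⊗[ℂ] H₀) : ‖toPre σ ρ x‖ ^ 2 = (form σ ρ x x).re := by
  rw [norm_sq_eq_re_inner (𝕜 := ℂ), inner_toPre]; rfl

/-- The Hilbert space `G = X ⊗_ρ H₀`, the interior tensor product over `A_0` of the Hilbert
C*-module `X` (the completion of `A` with respect to the `A_0`-valued inner product
`⟪a, b⟫ = P_0 (a^* b)`) and the Hilbert space `H₀`. Since `A` is dense in `X`, this is the
(Hausdorff) completion of `A ⊗ H₀` with respect to the semi-inner product
`⟪a ⊗ ξ, b ⊗ η⟫ = ⟪ξ, ρ (P_0 (a^* b)) η⟫`; the balancing relations over `A_0` hold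
in it because the corresponding vectors have norm zero. -/
abbrev LiftedSpace : Type _ := UniformSpace.Completion (PreTensor σ ρ)

/-- The simple tensor `a ⊗ ξ` in `G`. -/
noncomputable def simpleTensor (a : A) (ξ : H₀) : LiftedSpace σ ρ :=
  ((toPre σ ρ (a ⊗ₜ ξ) : PreTensor σ ρ) : LiftedSpace σ ρ)

theorem inner_simpleTensor (a b : A) (ξ η : H₀) :
    ⟪simpleTensor σ ρ a ξ, simpleTensor σ ρ b η⟫_ℂ = ⟪ξ, ρ (σ.condExpₗ (star a * b)) η⟫_ℂ := by
  rw [simpleTensor, simpleTensor, UniformSpace.Completion.inner_coe, inner_toPre, form_tmul]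

theorem simpleTensor_add_right (a : A) (ξ η : H₀) :
    simpleTensor σ ρ a (ξ + η) = simpleTensor σ ρ a ξ + simpleTensor σ ρ a η := by
  simp only [simpleTensor, TensorProduct.tmul_add, map_add, UniformSpace.Completion.coe_add]

theorem simpleTensor_smul_right (c : ℂ) (a : A) (ξ : H₀) :
    simpleTensor σ ρ a (c • ξ) = c • simpleTensor σ ρ a ξ := by
  simp only [simpleTensor, TensorProduct.tmul_smul, map_smul, UniformSpace.Completion.coe_smul]

theorem simpleTensor_add_left (a b : A) (ξ : H₀) :
    simpleTensor σ ρ (a + b) ξ = simpleTensor σ ρ a ξ + simpleTensor σ ρ b ξ := by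
  simp only [simpleTensor, TensorProduct.add_tmul, map_add, UniformSpace.Completion.coe_add]

theorem simpleTensor_smul_left (c : ℂ) (a : A) (ξ : H₀) :
    simpleTensor σ ρ (c • a) ξ = c • simpleTensor σ ρ a ξ := by
  simp only [simpleTensor, ← TensorProduct.smul_tmul', map_smul, UniformSpace.Completion.coe_smul]

/-- The creation operator `θ_a : H₀ → G`, `ξ ↦ a ⊗ ξ`. -/
noncomputable def creation (a : A) : H₀ →L[ℂ] LiftedSpace σ ρ :=
  LinearMap.mkContinuous
    { toFun := fun ξ => simpleTensor σ ρ a ξ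
      map_add' := simpleTensor_add_right σ ρ a
      map_smul' := fun c ξ => simpleTensor_smul_right σ ρ c a ξ }
    (√‖ρ (σ.condExpₗ (star a * a))‖) (fun ξ => by
      change ‖simpleTensor σ ρ a ξ‖ ≤ _
      refine le_of_sq_le_sq ?_ (by positivity)
      rw [mul_pow, Real.sq_sqrt (norm_nonneg _), norm_sq_eq_re_inner (𝕜 := ℂ),
        inner_simpleTensor]
      calc _ ≤ ‖ξ‖ * ‖ρ (σ.condExpₗ (star a * a)) ξ‖ := re_inner_le_norm _ _
        _ ≤ ‖ξ‖ * (‖ρ (σ.condExpₗ (star a * a))‖ * ‖ξ‖) := by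
          gcongr; exact ContinuousLinearMap.le_opNorm _ _
        _ = _ := by ring)

@[simp] theorem creation_apply (a : A) (ξ : H₀) : creation σ ρ a ξ = simpleTensor σ ρ a ξ := rfl

/-- The bounded operator on `G` induced by a linear map on `A ⊗ H₀` which is bounded for the
semi-inner product. -/
noncomputable def inducedOp (T : A ⊗[ℂ] H₀ →ₗ[ℂ] A ⊗[ℂ] H₀) (C : ℝ) (hC : 0 ≤ C)
    (hT : ∀ x, (form σ ρ (T x) (T x)).re ≤ C ^ 2 * (form σ ρ x x).re) :
    LiftedSpace σ ρ →L[ℂ] LiftedSpace σ ρ :=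
  (LinearMap.mkContinuous
    ((toPre σ ρ).toLinearMap ∘ₗ T ∘ₗ (toPre σ ρ).symm.toLinearMap) C (fun x => by
      refine le_of_sq_le_sq ?_ (by positivity)
      have h := hT ((toPre σ ρ).symm x)
      rwa [← norm_toPre_sq, ← norm_toPre_sq, LinearEquiv.apply_symm_apply, ← mul_pow] at h)).completion

theorem inducedOp_coe (T : A ⊗[ℂ] H₀ →ₗ[ℂ] A ⊗[ℂ] H₀) (C : ℝ) (hC : 0 ≤ C)
    (hT : ∀ x, (form σ ρ (T x) (T x)).re ≤ C ^ 2 * (form σ ρ x x).re) (x : A ⊗[ℂ] H₀) :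
    inducedOp σ ρ T C hC hT (toPre σ ρ x : PreTensor σ ρ) = (toPre σ ρ (T x) : PreTensor σ ρ) := by
  rw [inducedOp, ContinuousLinearMap.completion_apply_coe]
  rfl

/-- Two bounded operators on `G` agree if they agree on simple tensors. -/
theorem lifted_ext {E : Type*} [NormedAddCommGroup E] [NormedSpace ℂ E]
    {S T : LiftedSpace σ ρ →L[ℂ] E}
    (h : ∀ a ξ, S (simpleTensor σ ρ a ξ) = T (simpleTensor σ ρ a ξ)) : S = T := by
  have h2 : ∀ x : A ⊗[ℂ] H₀, S (toPre σ ρ x : PreTensor σ ρ) = T (toPre σ ρ x : PreTensor σ ρ) := by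
    intro x
    induction x with
    | zero => rw [map_zero, UniformSpace.Completion.coe_zero, map_zero, map_zero]
    | add x y hx hy =>
      simp only [map_add, UniformSpace.Completion.coe_add, hx, hy]
    | tmul a ξ => exact h a ξ
  ext x
  induction x using UniformSpace.Completion.induction_on with
  | hp => exact isClosed_eq S.continuous T.continuous
  | ih x => exact h2 ((toPre σ ρ).symm x)

theorem form_mul_left (a : A) (x y : A ⊗[ℂ] H₀) :
    form σ ρ (LinearMap.rTensor H₀ (LinearMap.mulLeft ℂ a) x) y =
      form σ ρ x (LinearMap.rTensor H₀ (LinearMap.mulLeft ℂ (star a)) y) := by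
  induction x with
  | zero => simp
  | add x x' hx hx' => simp only [map_add, LinearMap.add_apply, hx, hx']
  | tmul b ξ =>
    induction y with
    | zero => simp
    | add y y' hy hy' => simp only [map_add, hy, hy']
    | tmul c η => simp [form_tmul, mul_assoc]

theorem form_mul_left_le (a : A) (x : A ⊗[ℂ] H₀) :
    (form σ ρ (LinearMap.rTensor H₀ (LinearMap.mulLeft ℂ a) x)
      (LinearMap.rTensor H₀ (LinearMap.mulLeft ℂ a) x)).re ≤ ‖a‖ ^ 2 * (form σ ρ x x).re := by
  let _ : PartialOrder A := CStarAlgebra.spectralOrder A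
  have _ : StarOrderedRing A := CStarAlgebra.spectralOrderedRing A
  obtain ⟨c, hc⟩ := CStarAlgebra.nonneg_iff_eq_star_mul_self.mp
    (sub_nonneg.mpr (CStarAlgebra.star_mul_le_algebraMap_norm_sq (a := a)))
  have h1 : ∀ b : A, form σ ρ (LinearMap.rTensor H₀ (LinearMap.mulLeft ℂ b) x)
      (LinearMap.rTensor H₀ (LinearMap.mulLeft ℂ b) x)
      = form σ ρ x (LinearMap.rTensor H₀ (LinearMap.mulLeft ℂ (star b * b)) x) := by
    intro b
    rw [form_mul_left, LinearMap.mulLeft_mul, LinearMap.rTensor_comp, LinearMap.comp_apply]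
  have h2 := form_self_nonneg σ ρ (LinearMap.rTensor H₀ (LinearMap.mulLeft ℂ c) x)
  have h3 : LinearMap.mulLeft ℂ (star c * c)
      = ((‖a‖ ^ 2 : ℝ) : ℂ) • LinearMap.id - LinearMap.mulLeft ℂ (star a * a) := by
    ext b
    rw [LinearMap.mulLeft_apply, ← hc, sub_mul, Algebra.algebraMap_eq_smul_one, smul_one_mul,
      LinearMap.sub_apply, LinearMap.smul_apply, LinearMap.id_apply, LinearMap.mulLeft_apply]
    rfl
  rw [h1, h3, LinearMap.rTensor_sub, LinearMap.rTensor_smul, LinearMap.rTensor_id,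
    LinearMap.sub_apply, LinearMap.smul_apply, LinearMap.id_apply, map_sub, map_smul, ← h1,
    smul_eq_mul, Complex.sub_re, Complex.re_ofReal_mul] at h2
  linarith

/-- The representation `ψ ⊗ 1` of `A` on `G`, `a · (b ⊗ ξ) = (a b) ⊗ ξ`. -/
noncomputable def leftAction : A →⋆ₐ[ℂ] (LiftedSpace σ ρ →L[ℂ] LiftedSpace σ ρ) :=
  let f : A → (LiftedSpace σ ρ →L[ℂ] LiftedSpace σ ρ) := fun a =>
    inducedOp σ ρ (LinearMap.rTensor H₀ (LinearMap.mulLeft ℂ a)) ‖a‖ (norm_nonneg a)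
      (form_mul_left_le σ ρ a)
  have hf : ∀ a b ξ, f a (simpleTensor σ ρ b ξ) = simpleTensor σ ρ (a * b) ξ := fun a b ξ =>
    inducedOp_coe σ ρ _ _ _ _ _
  have h1 : f 1 = 1 := lifted_ext σ ρ fun b ξ => by simp [hf]
  have hadd : ∀ a b, f (a + b) = f a + f b := fun a b => lifted_ext σ ρ fun c ξ => by
    rw [add_apply, hf, hf, hf, add_mul, simpleTensor_add_left]
  have hsmul : ∀ (c : ℂ) (a : A), f (c • a) = c • f a := fun c a => lifted_ext σ ρ fun b ξ => by
    rw [smul_apply, hf, hf, smul_mul_assoc, simpleTensor_smul_left]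
  { toFun := f
    map_one' := h1
    map_mul' := fun a b => lifted_ext σ ρ fun c ξ => by simp [hf, mul_assoc]
    map_zero' := by simpa using hsmul 0 0
    map_add' := hadd
    commutes' := fun c => by
      rw [Algebra.algebraMap_eq_smul_one, hsmul, h1, Algebra.algebraMap_eq_smul_one]
    map_star' := fun a => by
      rw [ContinuousLinearMap.star_eq_adjoint, ContinuousLinearMap.eq_adjoint_iff]
      intro x y
      induction x, y using UniformSpace.Completion.induction_on₂ with
      | hp => apply isClosed_eq <;> fun_prop
      | ih x y =>
        obtain ⟨x, rfl⟩ := (toPre σ ρ).surjective x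
        obtain ⟨y, rfl⟩ := (toPre σ ρ).surjective y
        simp only [f, inducedOp_coe, UniformSpace.Completion.inner_coe, inner_toPre]
        rw [form_mul_left, star_star] }

theorem leftAction_simpleTensor (a b : A) (ξ : H₀) :
    leftAction σ ρ a (simpleTensor σ ρ b ξ) = simpleTensor σ ρ (a * b) ξ :=
  inducedOp_coe σ ρ _ ‖a‖ (norm_nonneg a) (form_mul_left_le σ ρ a) _

theorem form_act (z : Circle) (x y : A ⊗[ℂ] H₀) :
    form σ ρ (LinearMap.rTensor H₀ (σ.actCLM z).toLinearMap x)
      (LinearMap.rTensor H₀ (σ.actCLM z).toLinearMap y) = form σ ρ x y := by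
  induction x with
  | zero => simp
  | add x x' hx hx' => simp only [map_add, LinearMap.add_apply, hx, hx']
  | tmul b ξ =>
    induction y with
    | zero => simp
    | add y y' hy hy' => simp only [map_add, hy, hy']
    | tmul c η =>
      simp only [LinearMap.rTensor_tmul, ContinuousLinearMap.coe_coe, CircleAction.actCLM_apply,
        form_tmul, ← map_star, ← map_mul, CircleAction.condExpₗ_act]

/-- The unitary operator on `G` implementing `σ_z`, that is `b ⊗ ξ ↦ σ_z(b) ⊗ ξ`. -/
noncomputable def circleUnitary (z : Circle) : LiftedSpace σ ρ →L[ℂ] LiftedSpace σ ρ :=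
  inducedOp σ ρ (LinearMap.rTensor H₀ (σ.actCLM z).toLinearMap) 1 zero_le_one
    (fun x => by rw [form_act, one_pow, one_mul])

theorem circleUnitary_simpleTensor (z : Circle) (b : A) (ξ : H₀) :
    circleUnitary σ ρ z (simpleTensor σ ρ b ξ) = simpleTensor σ ρ (σ.toHom z b) ξ :=
  inducedOp_coe σ ρ _ 1 zero_le_one _ _

/-- The one-parameter group `V_s(μ)` of unitaries on `G`, implementing `σ_z` for
`z = exp (i s log(μ) / 2)`, so that `V_s(μ) = μ ^ (i s n / 2)` on `G_n`. -/
noncomputable def modularGroup (μ : ℝ) (s : ℝ) : LiftedSpace σ ρ →L[ℂ] LiftedSpace σ ρ :=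
  circleUnitary σ ρ (Circle.exp (s * Real.log μ / 2))

theorem modularGroup_simpleTensor {μ : ℝ} (hμ : 0 < μ) (s : ℝ) (n : ℤ) {x : A}
    (hx : x ∈ σ.spectralSubspace n) (ξ : H₀) :
    modularGroup σ ρ μ s (simpleTensor σ ρ x ξ) =
      ((μ : ℂ) ^ (Complex.I * s * n / 2)) • simpleTensor σ ρ x ξ := by
  rw [modularGroup, circleUnitary_simpleTensor, hx, simpleTensor_smul_left]
  congr 1
  rw [Circle.coe_exp, ← Complex.exp_int_mul,
    Complex.cpow_def_of_ne_zero (by exact_mod_cast hμ.ne'), ← Complex.ofReal_log hμ.le]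
  congr 1
  push_cast
  ring

theorem form_lTensor (γ : H₀ →L[ℂ] H₀) (hγ : star γ * γ = 1) (hc : ∀ a, Commute γ (ρ a))
    (x y : A ⊗[ℂ] H₀) :
    form σ ρ (LinearMap.lTensor A γ.toLinearMap x) (LinearMap.lTensor A γ.toLinearMap y) =
      form σ ρ x y := by
  induction x with
  | zero => simp
  | add x x' hx hx' => simp only [map_add, LinearMap.add_apply, hx, hx']
  | tmul b ξ =>
    induction y with
    | zero => simp
    | add y y' hy hy' => simp only [map_add, hy, hy']
    | tmul c η =>
      simp only [LinearMap.lTensor_tmul, ContinuousLinearMap.coe_coe, form_tmul]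
      rw [← mul_apply_eq_comp, ← (hc _).eq, mul_apply_eq_comp,
        ← ContinuousLinearMap.adjoint_inner_right, ← ContinuousLinearMap.star_eq_adjoint,
        ← mul_apply_eq_comp, hγ, one_apply_eq_self]

/-- The operator `1 ⊗ γ` on `G`, for an isometry `γ` of `H₀` commuting with `ρ`. -/
noncomputable def idTensor (γ : H₀ →L[ℂ] H₀) (hγ : star γ * γ = 1)
    (hc : ∀ a, Commute γ (ρ a)) : LiftedSpace σ ρ →L[ℂ] LiftedSpace σ ρ :=
  inducedOp σ ρ (LinearMap.lTensor A γ.toLinearMap) 1 zero_le_one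
    (fun x => by rw [form_lTensor σ ρ γ hγ hc, one_pow, one_mul])

theorem idTensor_simpleTensor (γ : H₀ →L[ℂ] H₀) (hγ : star γ * γ = 1)
    (hc : ∀ a, Commute γ (ρ a)) (b : A) (ξ : H₀) :
    idTensor σ ρ γ hγ hc (simpleTensor σ ρ b ξ) = simpleTensor σ ρ b (γ ξ) :=
  inducedOp_coe σ ρ _ 1 zero_le_one _ _

/-- The closed subspace `G_n = A_n ⊗_ρ H₀` of `G`. -/
noncomputable def gradedPart (n : ℤ) : Submodule ℂ (LiftedSpace σ ρ) :=
  (Submodule.span ℂ {g | ∃ x ∈ σ.spectralSubspace n, ∃ ξ : H₀,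
    g = simpleTensor σ ρ x ξ}).topologicalClosure

theorem simpleTensor_mem_gradedPart {n : ℤ} {x : A} (hx : x ∈ σ.spectralSubspace n) (ξ : H₀) :
    simpleTensor σ ρ x ξ ∈ gradedPart σ ρ n :=
  Submodule.le_topologicalClosure _ (Submodule.subset_span ⟨x, hx, ξ, rfl⟩)

/-- The graph of the positive invertible unbounded operator `Γ = V_{-i}(μ)` on `G`, which is the
closure of the operator acting as `μ ^ (n / 2)` on `G_n` for every `n`. -/
noncomputable def modularOperatorGraph (μ : ℝ) : Submodule ℂ (LiftedSpace σ ρ × LiftedSpace σ ρ) :=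
  (Submodule.span ℂ {p | ∃ n : ℤ, ∃ η ∈ gradedPart σ ρ n,
    p = (η, ((μ ^ ((n : ℝ) / 2) : ℝ) : ℂ) • η)}).topologicalClosure

end Tensor

section Operators

variable {H : Type*} [NormedAddCommGroup H] [InnerProductSpace ℂ H] [CompleteSpace H]

/-- The graph of the composition `T ∘ S` of two unbounded operators given by their graphs, with
its natural domain. -/
def graphComp (T S : Submodule ℂ (H × H)) : Submodule ℂ (H × H) where
  carrier := {p | ∃ y, (p.1, y) ∈ S ∧ (y, p.2) ∈ T}
  add_mem' := by
    rintro p q ⟨y, hy, hy'⟩ ⟨z, hz, hz'⟩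
    exact ⟨y + z, S.add_mem hy hz, T.add_mem hy' hz'⟩
  zero_mem' := ⟨0, S.zero_mem, T.zero_mem⟩
  smul_mem' := by
    rintro c p ⟨y, hy, hy'⟩
    exact ⟨c • y, S.smul_mem c hy, T.smul_mem c hy'⟩

/-- The bounded operator `S` extends the operator `D T - T' D` on the domain of `D`; in particular
`T` preserves the domain of `D`. -/
def ExtendsCommutator (D : H →ₗ.[ℂ] H) (T T' S : H →L[ℂ] H) : Prop :=
  ∀ ξ : D.domain, ∃ h : T ξ ∈ D.domain, S ξ = D ⟨T ξ, h⟩ - T' (D ξ)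

/-- A strongly continuous one-parameter group of unitaries. -/
structure IsUnitaryGroup (V : ℝ → (H →L[ℂ] H)) : Prop where
  mem_unitary : ∀ s, V s ∈ unitary (H →L[ℂ] H)
  map_zero : V 0 = 1
  map_add : ∀ s t, V (s + t) = V s * V t
  continuous_apply : ∀ ξ, Continuous fun s => V s ξ

/-- The closed strip between the real line and the line of imaginary part `r`, for any real `r`. -/
def strip (r : ℝ) : Set ℂ := {z | z.im ∈ Set.uIcc 0 r}

/-- `f` is the analytic extension to the strip `strip r` of `s ↦ V_s T V_s^*`. -/
structure IsAnalyticExtension (V : ℝ → (H →L[ℂ] H)) (r : ℝ) (T : H →L[ℂ] H)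
    (f : ℂ → (H →L[ℂ] H)) : Prop where
  continuousOn : ContinuousOn f (strip r)
  holomorphic : DifferentiableOn ℂ f (interior (strip r))
  apply_real : ∀ s : ℝ, f s = V s * T * star (V s)

/-- The bounded operator `T` is analytic of order `r` for the automorphism group `β` induced
by `V`. -/
def IsAnalyticOperator (V : ℝ → (H →L[ℂ] H)) (r : ℝ) (T : H →L[ℂ] H) : Prop :=
  ∃ f, IsAnalyticExtension V r T f

open scoped Classical in
/-- The operator `β_z(T)`, for `T` analytic of order the imaginary part of `z`
(and zero for other `T`). -/
noncomputable def analyticAut (V : ℝ → (H →L[ℂ] H)) (z : ℂ) (T : H →L[ℂ] H) : H →L[ℂ] H :=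
  if h : IsAnalyticOperator V z.im T then h.choose z else 0

/-- Twisted Lipschitz operators with respect to `D` and the automorphism group `β` induced
by `V`. -/
structure IsTwistedLipschitz (D : H →ₗ.[ℂ] H) (V : ℝ → (H →L[ℂ] H)) (T : H →L[ℂ] H) : Prop where
  analytic : IsAnalyticOperator V 1 T
  analytic_star : IsAnalyticOperator V 1 (star T)
  commutator : ∃ S : H →L[ℂ] H,
    ExtendsCommutator D (analyticAut V Complex.I T) (analyticAut V (-Complex.I) T) S

variable {B : Type*} [CStarAlgebra B]

/-- `(𝒞, H, D)` is a twisted Lipschitz triple on the unital C*-algebra `B`, represented on `H`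
by `π`, with respect to the one-parameter group `V`. -/
structure IsTwistedLipschitzTriple (𝒞 : StarSubalgebra ℂ B) (π : B →⋆ₐ[ℂ] (H →L[ℂ] H))
    (D : H →ₗ.[ℂ] H) (V : ℝ → (H →L[ℂ] H)) : Prop where
  separable : TopologicalSpace.SeparableSpace H
  dense : Dense (𝒞 : Set B)
  injective : Function.Injective π
  selfAdjoint : IsSelfAdjoint D
  unitaryGroup : IsUnitaryGroup V
  lipschitz : ∀ a ∈ 𝒞, IsTwistedLipschitz D V (π a)

/-- `(𝒞, H, D)` is a Lipschitz triple on the unital C*-algebra `B`, represented on `H`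
by `π`; the bounded extension of the commutator `[D, π(a)]` is `δ a` for `a` in `𝒞`. -/
structure IsLipschitzTriple (𝒞 : StarSubalgebra ℂ B) (π : B →⋆ₐ[ℂ] (H →L[ℂ] H))
    (D : H →ₗ.[ℂ] H) (δ : 𝒞 → (H →L[ℂ] H)) : Prop where
  separable : TopologicalSpace.SeparableSpace H
  dense : Dense (𝒞 : Set B)
  injective : Function.Injective π
  selfAdjoint : IsSelfAdjoint D
  lipschitz : ∀ a : 𝒞, ExtendsCommutator D (π a) (π a) (δ a)

/-- `γ` is a grading operator for a twisted Lipschitz triple with representation `π`, one-parameter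
group `V` and unbounded operator `D`. -/
structure IsGradingOperator (π : B →⋆ₐ[ℂ] (H →L[ℂ] H)) (V : ℝ → (H →L[ℂ] H))
    (D : H →ₗ.[ℂ] H) (γ : H →L[ℂ] H) : Prop where
  selfAdjoint : star γ = γ
  unitary : star γ * γ = 1
  comm_rep : ∀ a, Commute γ (π a)
  comm_group : ∀ s, Commute γ (V s)
  anticomm : ∀ ξ : D.domain, ∃ h : γ ξ ∈ D.domain, D ⟨γ ξ, h⟩ = -γ (D ξ)

end Operators

section Lift

variable {A : Type*} [CStarAlgebra A] (σ : CircleAction A) (𝒜 : StarSubalgebra ℂ A)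

/-- The subalgebra `𝒜 ∩ A_0`, as a *-subalgebra of `A_0`. -/
noncomputable def coreFixed : StarSubalgebra ℂ σ.fixedAlgebra := 𝒜.comap σ.fixedAlgebra.subtype

/-- The subspace `𝒜_n = 𝒜 ∩ A_n`. -/
noncomputable def coreGraded (n : ℤ) : Submodule ℂ A :=
  Subalgebra.toSubmodule 𝒜.toSubalgebra ⊓ σ.spectralSubspace n

variable {σ 𝒜}

/-- The inclusion of `𝒜_n` in `𝒜`. -/
noncomputable def coreGraded.toCore {n : ℤ} (x : coreGraded σ 𝒜 n) : 𝒜 := ⟨x, x.2.1⟩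

/-- The inner product `⟪x, y⟫ = x^* y` on `𝒜_n`, with values in `𝒜 ∩ A_0`. -/
noncomputable def coreGraded.pairing {n : ℤ} (x y : coreGraded σ 𝒜 n) : coreFixed σ 𝒜 :=
  ⟨⟨star (x : A) * y, fun z => by
    rw [map_mul, map_star, x.2.2 z, y.2.2 z, star_smul, smul_mul_smul_comm, star_zpow₀,
      ← mul_zpow, Complex.star_def, ← Complex.normSq_eq_conj_mul_self, Circle.normSq_coe,
      Complex.ofReal_one, one_zpow, one_smul]⟩,
    𝒜.mul_mem (𝒜.star_mem' x.2.1) y.2.1⟩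

variable {H₀ : Type*} [NormedAddCommGroup H₀] [InnerProductSpace ℂ H₀] [CompleteSpace H₀]
variable {H : Type*} [NormedAddCommGroup H] [InnerProductSpace ℂ H] [CompleteSpace H]
variable (ρ : σ.fixedAlgebra →⋆ₐ[ℂ] (H₀ →L[ℂ] H₀))

/-- The standing conditions: `𝒜` is generated by `𝒜 ∩ A_1` as a *-algebra, `H₀` is a closed
subspace of `H` (through the isometry `ι`), and `φ`, `δ`, `μ` satisfy the three conditions of the
twisted setting with respect to `ρ` and the derivation `δ₀` on `𝒜 ∩ A_0`. -/
structure ExponentialAssumption (δ₀ : coreFixed σ 𝒜 → (H₀ →L[ℂ] H₀)) (ι : H₀ →ₗᵢ[ℂ] H)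
    (φ : A →⋆ₐ[ℂ] (H →L[ℂ] H)) (δ : 𝒜 →ₗ[ℂ] (H →L[ℂ] H)) (μ : ℝ) : Prop where
  generated : StarAlgebra.adjoin ℂ (coreGraded σ 𝒜 1 : Set A) = 𝒜
  derivation_restrict : ∀ (a : 𝒜) (ha : (a : A) ∈ σ.fixedAlgebra) (ξ : H₀),
    δ a (ι ξ) = ι (δ₀ ⟨⟨a, ha⟩, a.2⟩ ξ)
  rep_restrict : ∀ (a : 𝒜) (ha : (a : A) ∈ σ.fixedAlgebra) (ξ : H₀),
    φ a (ι ξ) = ι (ρ ⟨a, ha⟩ ξ)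
  pos : 0 < μ
  twisted_leibniz : ∀ (n : ℤ) (a b : 𝒜), (a : A) ∈ σ.spectralSubspace n →
    δ (a * b) = δ a * φ b + ((μ ^ n : ℝ) : ℂ) • (φ a * δ b)
  right_frame : ∃ (k : ℕ) (ζ : Fin k → 𝒜), (∀ j, (ζ j : A) ∈ σ.spectralSubspace 1) ∧
    ∑ j, ζ j * star (ζ j) = 1 ∧ ∑ j, φ (ζ j) * δ (star (ζ j)) = 0
  left_frame : ∃ (k : ℕ) (ζ : Fin k → 𝒜), (∀ j, (ζ j : A) ∈ σ.spectralSubspace 1) ∧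
    ∑ j, star (ζ j) * ζ j = 1 ∧ ∑ j, star (φ (ζ j)) * δ (ζ j) = 0

/-- A finite frame for `𝒜_n ⊆ A_n` such that `∑ φ(ζ_j) δ(ζ_j^*) = 0`. -/
structure IsVanishingFrame (φ : A →⋆ₐ[ℂ] (H →L[ℂ] H)) (δ : 𝒜 →ₗ[ℂ] (H →L[ℂ] H)) {n : ℤ} {k : ℕ}
    (ζ : Fin k → coreGraded σ 𝒜 n) : Prop where
  frame : ∀ x : coreGraded σ 𝒜 n, ∑ j, (ζ j : A) * (star (ζ j : A) * x) = x
  vanish : ∑ j, φ (ζ j) * δ (star (coreGraded.toCore (ζ j))) = 0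

/-- The Grassmann connection `∇(x) = ∑ ζ_j ⊗ δ₀(⟪ζ_j, x⟫)` of a finite frame of `𝒜_n`. An element
`y ⊗ T` of the interior tensor product `A_n ⊗_ρ L(H₀)` is identified with the operator
`ξ ↦ y ⊗ T ξ` from `H₀` to `G`. -/
noncomputable def grassmannConnection (δ₀ : coreFixed σ 𝒜 → (H₀ →L[ℂ] H₀)) {n : ℤ} {k : ℕ}
    (ζ : Fin k → coreGraded σ 𝒜 n) (x : coreGraded σ 𝒜 n) : H₀ →L[ℂ] LiftedSpace σ ρ :=
  ∑ j, creation σ ρ (ζ j : A) ∘L δ₀ (coreGraded.pairing (ζ j) x)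

/-- The graph of the horizontal lift `1 ⊗_∇ D₀`, defined on the span of the vectors `x ⊗ ξ` for
`x` in `𝒜` and `ξ` in the domain of `D₀` by `x ⊗ ξ ↦ ∇(x) ξ + x ⊗ D₀ ξ`, where `∇` is the direct
sum of the Grassmann connections of given frames of all the `𝒜_n`. -/
noncomputable def horizontalLiftGraph (D₀ : H₀ →ₗ.[ℂ] H₀) (δ₀ : coreFixed σ 𝒜 → (H₀ →L[ℂ] H₀))
    {m : ℤ → ℕ} (ζ : ∀ n, Fin (m n) → coreGraded σ 𝒜 n) :
    Submodule ℂ (LiftedSpace σ ρ × LiftedSpace σ ρ) :=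
  Submodule.span ℂ {p | ∃ (n : ℤ) (x : coreGraded σ 𝒜 n) (ξ : D₀.domain),
    p = (simpleTensor σ ρ (x : A) ξ,
      grassmannConnection ρ δ₀ (ζ n) x ξ + simpleTensor σ ρ (x : A) (D₀ ξ))}

/-- The closure of the graph of `Γ² (1 ⊗_∇ D₀)`. -/
noncomputable def modularLiftGraph (D₀ : H₀ →ₗ.[ℂ] H₀) (δ₀ : coreFixed σ 𝒜 → (H₀ →L[ℂ] H₀))
    (μ : ℝ) {m : ℤ → ℕ} (ζ : ∀ n, Fin (m n) → coreGraded σ 𝒜 n) :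
    Submodule ℂ (LiftedSpace σ ρ × LiftedSpace σ ρ) :=
  (graphComp (modularOperatorGraph σ ρ μ) (graphComp (modularOperatorGraph σ ρ μ)
    (horizontalLiftGraph ρ D₀ δ₀ ζ))).topologicalClosure

/-- The modular lift `D_Γ`, the closure of `Γ² (1 ⊗_∇ D₀)`. -/
noncomputable def modularLift (D₀ : H₀ →ₗ.[ℂ] H₀) (δ₀ : coreFixed σ 𝒜 → (H₀ →L[ℂ] H₀))
    (μ : ℝ) {m : ℤ → ℕ} (ζ : ∀ n, Fin (m n) → coreGraded σ 𝒜 n) :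
    LiftedSpace σ ρ →ₗ.[ℂ] LiftedSpace σ ρ :=
  (modularLiftGraph ρ D₀ δ₀ μ ζ).toLinearPMap

end Lift

end ModularLift

open ModularLift

/-!
The Hilbert space `G` is the orthogonal sum of the closed subspaces `G_n`, and the whole argument
takes place in one degree at a time, with two pictures of `G_n`.

*The frame picture.* If `(ζ_j)` is a frame of `A_n`, then every `g` in `G_n` has the expansion
`g = ∑ θ_{ζ_j} θ_{ζ_j}^* g`, where `θ_a ξ = a ⊗ ξ` (`sum_creation_adjoint`). In these terms the
horizontal lift is the compression `∑ θ_{ζ_j} D₀ θ_{ζ_j}^*` (`horizontalVector_eq_sum`), so it is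
symmetric; and if `y` is in the domain of its adjoint, then each `θ_{ζ_j}^* y` is in the domain of
`D₀^* = D₀`, so that `y` is a finite sum of vectors `x ⊗ ξ` in the domain
(`mem_coreGraph_of_mem_adjoint`). As every vector of `G` is the sum of its components, the closure
of `Γ² (1 ⊗_∇ D₀)` is the adjoint of its restriction to the core spanned by the `x ⊗ ξ`, and
therefore a selfadjoint operator (`modularLiftGraph_eq_adjoint`, `isSelfAdjoint_modularLift`).

*The picture on `H`.* The map `x ⊗ ξ ↦ φ(x) ξ` is isometric on `G_n`, and since the frame satisfies
`∑ φ(ζ_j) δ(ζ_j^*) = 0`, the twisted Leibniz rule turns the Grassmann connection into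
`μ ^ (-n) δ(x) ξ` (`transport_horizontalVector`). A second application of the Leibniz rule shows
that the twisted commutator of the modular lift with `a ∈ 𝒜_n` is `μ ^ (-n / 2) δ(a)` on each `G_k`
(`apply_commutator`). These blocks are uniformly bounded and shift the degree by `n`, so they form
a bounded operator on `G` (`exists_blockOperator`), which is the value of the twisted derivation.

The operators `β_{± i}` are defined by analytic continuation. They are computed from the explicit
continuation on homogeneous elements and the uniqueness of continuations which are only continuous
on the real line (`eqOn_zero_strip`). Frames in degree `n` are the products of `|n|` frames in
degree `± 1` (`hasUnitFrame`).
-/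

namespace ModularLift

/-! ### Spectral subspaces and the expectation onto the fixed point algebra -/

namespace CircleAction

variable {A : Type*} [CStarAlgebra A] (σ : CircleAction A)

theorem mul_mem_spectralSubspace {n m : ℤ} {a b : A} (ha : a ∈ σ.spectralSubspace n)
    (hb : b ∈ σ.spectralSubspace m) : a * b ∈ σ.spectralSubspace (n + m) := fun z => by
  rw [map_mul, ha z, hb z, smul_mul_smul_comm, zpow_add₀ (Circle.coe_ne_zero z)]

theorem star_mem_spectralSubspace {n : ℤ} {a : A} (ha : a ∈ σ.spectralSubspace n) :
    star a ∈ σ.spectralSubspace (-n) := fun z => by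
  rw [map_star, ha z, star_smul, star_zpow₀, Complex.star_def, ← Circle.coe_inv_eq_conj,
    Circle.coe_inv, inv_zpow, zpow_neg]

theorem mem_fixedAlgebra_iff {a : A} : a ∈ σ.fixedAlgebra ↔ a ∈ σ.spectralSubspace 0 :=
  forall_congr' fun z => by rw [zpow_zero, one_smul]

theorem star_mul_mem_fixedAlgebra {n : ℤ} {a b : A} (ha : a ∈ σ.spectralSubspace n)
    (hb : b ∈ σ.spectralSubspace n) : star a * b ∈ σ.fixedAlgebra := by
  rw [mem_fixedAlgebra_iff]
  simpa using σ.mul_mem_spectralSubspace (σ.star_mem_spectralSubspace ha) hb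

theorem condExpₗ_of_mem {a : A} (ha : a ∈ σ.fixedAlgebra) : σ.condExpₗ a = ⟨a, ha⟩ := by
  apply Subtype.ext
  have h : ∀ t : ℝ, σ.toHom (Circle.exp t) a = a := fun t => ha _
  rw [coe_condExpₗ, condExp]
  simp only [h, intervalIntegral.integral_const, sub_zero, smul_smul]
  rw [inv_mul_cancel₀ (by positivity), one_smul]

theorem condExpₗ_mul_fixed (b : A) (a : σ.fixedAlgebra) :
    σ.condExpₗ (b * a) = σ.condExpₗ b * a := by
  apply Subtype.ext
  have h := ((ContinuousLinearMap.mul ℝ A).flip (a : A)).intervalIntegral_comp_comm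
    (σ.intervalIntegrable_orbit b 0 (2 * Real.pi))
  have ha : ∀ t : ℝ, σ.toHom (Circle.exp t) a = a := fun t => a.2 _
  simp only [ContinuousLinearMap.flip_apply, ContinuousLinearMap.mul_apply'] at h
  simp only [coe_condExpₗ, condExp, MulMemClass.coe_mul, map_mul, ha, h, smul_mul_assoc]

theorem condExpₗ_of_mem_spectralSubspace {n : ℤ} (hn : n ≠ 0) {a : A}
    (ha : a ∈ σ.spectralSubspace n) : σ.condExpₗ a = 0 := by
  have h := σ.condExpₗ_act (Circle.exp (Real.pi / n)) a
  have hz : ((Circle.exp (Real.pi / n) : Circle) : ℂ) ^ n = -1 := by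
    have hn' : (n : ℂ) ≠ 0 := by exact_mod_cast hn
    rw [Circle.coe_exp, ← Complex.exp_int_mul, ← Complex.exp_pi_mul_I]
    congr 1
    push_cast
    field_simp
  rw [ha, hz, map_smul, neg_smul, one_smul] at h
  have h2 : (2 : ℂ) • σ.condExpₗ a = 0 := by
    rw [two_smul]; nth_rewrite 1 [← h]; simp
  exact (smul_eq_zero.mp h2).resolve_left two_ne_zero

theorem condExpₗ_star_mul_of_ne {n m : ℤ} (hnm : n ≠ m) {a b : A} (ha : a ∈ σ.spectralSubspace n)
    (hb : b ∈ σ.spectralSubspace m) : σ.condExpₗ (star a * b) = 0 :=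
  σ.condExpₗ_of_mem_spectralSubspace (n := -n + m) (by omega)
    (σ.mul_mem_spectralSubspace (σ.star_mem_spectralSubspace ha) hb)

/-- The expectation is faithful: the primitive of the positive function `t ↦ σ_{exp (it)} (a^* a)`
is increasing, so it vanishes on `[0, 2π]` if it vanishes at the right end point, and then its
derivative vanishes too. -/
theorem eq_zero_of_condExpₗ_star_mul_self {a : A} (h : σ.condExpₗ (star a * a) = 0) : a = 0 := by
  let _ : PartialOrder A := CStarAlgebra.spectralOrder A
  have _ : StarOrderedRing A := CStarAlgebra.spectralOrderedRing A
  set F : ℝ → A := fun t => σ.toHom (Circle.exp t) (star a * a) with hF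
  have hpos : ∀ t, 0 ≤ F t := fun t => by
    simp only [hF, map_mul, map_star]
    exact star_mul_self_nonneg _
  have hint : ∀ s t, IntervalIntegrable F volume s t := σ.intervalIntegrable_orbit _
  have h0 : ∫ t in (0 : ℝ)..(2 * Real.pi), F t = 0 := by
    have := congrArg (Subtype.val) h
    rw [coe_condExpₗ, condExp] at this
    exact (smul_eq_zero.mp this).resolve_left (by positivity)
  have hnn : ∀ s t, s ≤ t → 0 ≤ ∫ u in s..t, F u := fun s t hst => by
    rw [intervalIntegral.integral_of_le hst]
    exact integral_nonneg hpos
  have hz : ∀ x ∈ Set.Ioo (0 : ℝ) (2 * Real.pi), ∫ t in (0 : ℝ)..x, F t = 0 := fun x hx => by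
    refine le_antisymm ?_ (hnn 0 x hx.1.le)
    have h1 := intervalIntegral.integral_add_adjacent_intervals (hint 0 x) (hint x (2 * Real.pi))
    rw [h0] at h1
    rw [eq_neg_of_add_eq_zero_left h1]
    exact neg_nonpos.mpr (hnn _ _ hx.2.le)
  have hpi : Real.pi ∈ Set.Ioo (0 : ℝ) (2 * Real.pi) := ⟨Real.pi_pos, by linarith [Real.pi_pos]⟩
  have hd : HasDerivAt (fun x => ∫ t in (0 : ℝ)..x, F t) (F Real.pi) Real.pi :=
    intervalIntegral.integral_hasDerivAt_right (hint _ _)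
      (σ.continuous_orbit _).stronglyMeasurable.stronglyMeasurableAtFilter
      (σ.continuous_orbit _).continuousAt
  have hd' : HasDerivAt (fun x => ∫ t in (0 : ℝ)..x, F t) 0 Real.pi :=
    (hasDerivAt_const Real.pi (0 : A)).congr_of_eventuallyEq
      (Filter.eventuallyEq_of_mem (Ioo_mem_nhds hpi.1 hpi.2) hz)
  have h3 : σ.toHom (Circle.exp Real.pi) (star a * a) = 0 := hd.unique hd'
  exact CStarRing.star_mul_self_eq_zero_iff a |>.mp
    ((map_eq_zero_iff _ (EquivLike.injective (σ.toHom (Circle.exp Real.pi)))).mp h3)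

end CircleAction

section Core

variable {A : Type*} [CStarAlgebra A] {σ : CircleAction A} {𝒜 : StarSubalgebra ℂ A}

/-- If `𝒜` is generated by `𝒜_1`, then it is the sum of its homogeneous parts `𝒜_n`. -/
theorem mem_iSup_coreGraded (hgen : StarAlgebra.adjoin ℂ (coreGraded σ 𝒜 1 : Set A) = 𝒜) {a : A}
    (ha : a ∈ 𝒜) : a ∈ ⨆ n, coreGraded σ 𝒜 n := by
  have hmem : ∀ n, ∀ x ∈ coreGraded σ 𝒜 n, x ∈ ⨆ n, coreGraded σ 𝒜 n := fun n x hx =>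
    Submodule.mem_iSup_of_mem n hx
  rw [← hgen] at ha
  induction ha using StarAlgebra.adjoin_induction with
  | mem x hx => exact hmem 1 x hx
  | algebraMap r =>
    refine hmem 0 _ ⟨𝒜.algebraMap_mem r, ?_⟩
    exact (σ.mem_fixedAlgebra_iff).mp (σ.fixedAlgebra.algebraMap_mem r)
  | add x y _ _ hx hy => exact add_mem hx hy
  | mul x y hx' hy' hx hy =>
    clear hx' hy'
    induction hx using Submodule.iSup_induction' with
    | zero => simp
    | add x x' _ _ hx hx' => rw [add_mul]; exact add_mem hx hx'
    | mem n x hx =>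
      induction hy using Submodule.iSup_induction' with
      | zero => simp
      | add y y' _ _ hy hy' => rw [mul_add]; exact add_mem hy hy'
      | mem m y hy =>
        exact hmem (n + m) _ ⟨𝒜.mul_mem hx.1 hy.1, σ.mul_mem_spectralSubspace hx.2 hy.2⟩
  | star x hx' hx =>
    clear hx'
    induction hx using Submodule.iSup_induction' with
    | zero => simp
    | add x x' _ _ hx hx' => rw [star_add]; exact add_mem hx hx'
    | mem n x hx =>
      exact hmem (-n) _ ⟨𝒜.star_mem' hx.1, σ.star_mem_spectralSubspace hx.2⟩

/-- A property of the elements of `𝒜` which is additive holds if it holds for the homogeneous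
elements. -/
theorem homogeneous_induction (hgen : StarAlgebra.adjoin ℂ (coreGraded σ 𝒜 1 : Set A) = 𝒜)
    {p : 𝒜 → Prop} (hom : ∀ (n : ℤ) (a : 𝒜), (a : A) ∈ σ.spectralSubspace n → p a)
    (add : ∀ a b, p a → p b → p (a + b)) (a : 𝒜) : p a := by
  have h : ∀ x ∈ ⨆ n, coreGraded σ 𝒜 n, ∃ hx : x ∈ 𝒜, p ⟨x, hx⟩ := by
    intro x hx
    induction hx using Submodule.iSup_induction' with
    | zero => exact ⟨𝒜.zero_mem, hom 0 ⟨0, 𝒜.zero_mem⟩ (Submodule.zero_mem _)⟩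
    | add x y _ _ hx hy =>
      obtain ⟨hx, hpx⟩ := hx
      obtain ⟨hy, hpy⟩ := hy
      exact ⟨𝒜.add_mem hx hy, add _ _ hpx hpy⟩
    | mem n x hx => exact ⟨hx.1, hom n ⟨x, hx.1⟩ hx.2⟩
  exact (h a (mem_iSup_coreGraded hgen a.2)).2

end Core

/-! ### Frames -/

section Frames

variable {A : Type*} [CStarAlgebra A] {σ : CircleAction A} {𝒜 : StarSubalgebra ℂ A}
variable {H₀ : Type*} [NormedAddCommGroup H₀] [InnerProductSpace ℂ H₀] [CompleteSpace H₀]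
variable {H : Type*} [NormedAddCommGroup H] [InnerProductSpace ℂ H] [CompleteSpace H]
variable {ρ : σ.fixedAlgebra →⋆ₐ[ℂ] (H₀ →L[ℂ] H₀)} {δ₀ : coreFixed σ 𝒜 → (H₀ →L[ℂ] H₀)}
variable {ι : H₀ →ₗᵢ[ℂ] H} {φ : A →⋆ₐ[ℂ] (H →L[ℂ] H)} {δ : 𝒜 →ₗ[ℂ] (H →L[ℂ] H)} {μ : ℝ}

variable (σ φ δ) in
/-- There is a finite family in `𝒜_n` with `∑ ζ_j ζ_j^* = 1` and `∑ φ(ζ_j) δ(ζ_j^*) = 0`. -/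
def HasUnitFrame (n : ℤ) : Prop :=
  ∃ (s : Type) (_ : Fintype s) (ζ : s → 𝒜), (∀ j, (ζ j : A) ∈ σ.spectralSubspace n) ∧
    ∑ j, ζ j * star (ζ j) = 1 ∧ ∑ j, φ (ζ j) * δ (star (ζ j)) = 0

namespace ExponentialAssumption

variable (h : ExponentialAssumption ρ δ₀ ι φ δ μ)
include h

theorem map_one_eq_zero : δ 1 = 0 := by
  have h1 := h.twisted_leibniz 0 1 1 (by
    rw [← σ.mem_fixedAlgebra_iff]; exact σ.fixedAlgebra.one_mem)
  simpa using h1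

/-- The products of two frames form a frame. -/
theorem hasUnitFrame_add {n m : ℤ} (hn : HasUnitFrame σ φ δ n) (hm : HasUnitFrame σ φ δ m) :
    HasUnitFrame σ φ δ (n + m) := by
  obtain ⟨s, _, ζ, hζ, hζ1, hζ0⟩ := hn
  obtain ⟨t, _, ω, hω, hω1, hω0⟩ := hm
  have hφ : ∑ j, φ (ω j) * φ (star (ω j : A)) = 1 := by
    have := congrArg (fun x : 𝒜 => φ x) hω1
    simpa using this
  refine ⟨s × t, inferInstance, fun j => ζ j.1 * ω j.2,
    fun j => σ.mul_mem_spectralSubspace (hζ j.1) (hω j.2), ?_, ?_⟩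
  · rw [Fintype.sum_prod_type, ← hζ1]
    refine Finset.sum_congr rfl fun i _ => ?_
    have : ∀ j, ζ i * ω j * star (ζ i * ω j) = ζ i * (ω j * star (ω j)) * star (ζ i) := fun j => by
      rw [star_mul]; simp only [mul_assoc]
    simp only [this]
    rw [← Finset.sum_mul, ← Finset.mul_sum, hω1, mul_one]
  · have hterm : ∀ i j, φ ((ζ i * ω j : 𝒜) : A) * δ (star (ζ i * ω j)) =
        φ (ζ i) * (φ (ω j) * δ (star (ω j))) * φ (star (ζ i : A)) +
          ((μ ^ (-m) : ℝ) : ℂ) •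
            (φ (ζ i) * (φ (ω j) * φ (star (ω j : A))) * δ (star (ζ i))) := fun i j => by
      rw [star_mul, h.twisted_leibniz (-m) _ _ (σ.star_mem_spectralSubspace (hω j))]
      simp only [MulMemClass.coe_mul, map_mul, mul_add, mul_smul_comm, mul_assoc]
      rfl
    rw [Fintype.sum_prod_type]
    simp only [hterm, Finset.sum_add_distrib, ← Finset.smul_sum, ← Finset.sum_mul,
      ← Finset.mul_sum, hω0, hφ, mul_zero, zero_mul, mul_one, hζ0, Finset.sum_const_zero,
      smul_zero, add_zero]

theorem hasUnitFrame (n : ℤ) : HasUnitFrame σ φ δ n := by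
  have h0 : HasUnitFrame σ φ δ 0 := by
    refine ⟨Unit, inferInstance, fun _ => 1, fun _ => ?_, by simp, ?_⟩
    · rw [← σ.mem_fixedAlgebra_iff]; exact σ.fixedAlgebra.one_mem
    · simp [h.map_one_eq_zero]
  have h1 : HasUnitFrame σ φ δ 1 := by
    obtain ⟨k, ζ, hζ⟩ := h.right_frame
    exact ⟨Fin k, inferInstance, ζ, hζ⟩
  have h2 : HasUnitFrame σ φ δ (-1) := by
    obtain ⟨k, ζ, hζ, hζ1, hζ0⟩ := h.left_frame
    refine ⟨Fin k, inferInstance, fun j => star (ζ j),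
      fun j => σ.star_mem_spectralSubspace (hζ j), by simpa using hζ1, ?_⟩
    simpa [map_star] using hζ0
  induction n using Int.induction_on with
  | zero => exact h0
  | succ n hn => exact h.hasUnitFrame_add hn h1
  | pred n hn => exact h.hasUnitFrame_add hn h2

theorem exists_vanishingFrame (n : ℤ) :
    ∃ (k : ℕ) (ζ : Fin k → coreGraded σ 𝒜 n), IsVanishingFrame φ δ ζ := by
  obtain ⟨s, _, ζ, hζ, hζ1, hζ0⟩ := h.hasUnitFrame n
  let e := (Fintype.equivFin s).symm
  refine ⟨Fintype.card s, fun j => ⟨ζ (e j), (ζ (e j)).2, hζ (e j)⟩, fun x => ?_, ?_⟩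
  · have h1 := congrArg (fun y : 𝒜 => (y : A) * x) (e.sum_comp (fun j => ζ j * star (ζ j)))
    rw [hζ1] at h1
    simpa [Finset.sum_mul, mul_assoc] using h1
  · exact (e.sum_comp (fun j => φ (ζ j) * δ (star (ζ j)))).trans hζ0

/-- The frame property on `𝒜_n` self-improves to the identity `∑ ζ_j ζ_j^* = 1` in `A`, since the
unit is itself a sum of elements of `𝒜_n` multiplied by elements of `A`. -/
theorem sum_frame_mul_star {n : ℤ} {k : ℕ} {ζ : Fin k → coreGraded σ 𝒜 n}
    (hζ : IsVanishingFrame φ δ ζ) : ∑ j, (ζ j : A) * star (ζ j : A) = 1 := by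
  obtain ⟨s, _, ω, hω, hω1, -⟩ := h.hasUnitFrame n
  have hω1' : ∑ i, (ω i : A) * star (ω i : A) = 1 := by
    simpa using congrArg (Subtype.val) hω1
  calc ∑ j, (ζ j : A) * star (ζ j : A)
      = (∑ j, (ζ j : A) * star (ζ j : A)) * ∑ i, (ω i : A) * star (ω i : A) := by
        rw [hω1', mul_one]
    _ = ∑ i, (∑ j, (ζ j : A) * (star (ζ j : A) * ω i)) * star (ω i : A) := by
        rw [Finset.mul_sum]
        simp only [Finset.sum_mul, mul_assoc]
    _ = 1 := by
        rw [← hω1']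
        exact Finset.sum_congr rfl fun i _ => by rw [hζ.frame ⟨ω i, (ω i).2, hω i⟩]

end ExponentialAssumption

end Frames

/-! ### The graded Hilbert space -/

section Graded

variable {A : Type*} [CStarAlgebra A] (σ : CircleAction A)
variable {H₀ : Type*} [NormedAddCommGroup H₀] [InnerProductSpace ℂ H₀] [CompleteSpace H₀]
variable (ρ : σ.fixedAlgebra →⋆ₐ[ℂ] (H₀ →L[ℂ] H₀))

theorem adjoint_creation_simpleTensor (a x : A) (ξ : H₀) :
    (creation σ ρ a).adjoint (simpleTensor σ ρ x ξ) = ρ (σ.condExpₗ (star a * x)) ξ :=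
  ext_inner_left ℂ fun η => by
    rw [ContinuousLinearMap.adjoint_inner_right, creation_apply, inner_simpleTensor]

theorem simpleTensor_mul_fixed (x : A) (a : σ.fixedAlgebra) (ξ : H₀) :
    simpleTensor σ ρ (x * a) ξ = simpleTensor σ ρ x (ρ a ξ) := by
  have h : (creation σ ρ (x * (a : A))).adjoint = (creation σ ρ x ∘L ρ a).adjoint := by
    refine lifted_ext σ ρ fun y η => ?_
    have h1 : star (x * (a : A)) * y = star (star y * x * (a : A)) := by simp [mul_assoc]
    have h2 : star x * y = star (star y * x) := by simp
    rw [ContinuousLinearMap.adjoint_comp, ContinuousLinearMap.comp_apply,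
      adjoint_creation_simpleTensor, adjoint_creation_simpleTensor, h1, σ.condExpₗ_star,
      σ.condExpₗ_mul_fixed, star_mul, ← σ.condExpₗ_star, ← h2, map_mul, map_star]
    rfl
  have h2 := congrArg ContinuousLinearMap.adjoint h
  rw [ContinuousLinearMap.adjoint_adjoint, ContinuousLinearMap.adjoint_adjoint] at h2
  exact congrArg (fun T : H₀ →L[ℂ] LiftedSpace σ ρ => T ξ) h2

open scoped CStarAlgebra in
theorem continuous_simpleTensor_left (ξ : H₀) : Continuous fun a => simpleTensor σ ρ a ξ := by
  have h : ∀ a, simpleTensor σ ρ a ξ = leftAction σ ρ a (simpleTensor σ ρ 1 ξ) := fun a => by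
    rw [leftAction_simpleTensor, mul_one]
  rw [funext h]
  have hc : Continuous (leftAction σ ρ) := map_continuous (leftAction σ ρ)
  fun_prop

theorem isClosed_gradedPart (n : ℤ) : IsClosed (gradedPart σ ρ n : Set (LiftedSpace σ ρ)) :=
  Submodule.isClosed_topologicalClosure _

/-- A closed subspace which contains all `x ⊗ ξ` with `x ∈ A_n` contains `G_n`. -/
theorem gradedPart_le {n : ℤ} {K : Submodule ℂ (LiftedSpace σ ρ)}
    (hK : IsClosed (K : Set (LiftedSpace σ ρ)))
    (h : ∀ x ∈ σ.spectralSubspace n, ∀ ξ, simpleTensor σ ρ x ξ ∈ K) : gradedPart σ ρ n ≤ K := by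
  refine Submodule.topologicalClosure_minimal _ (Submodule.span_le.mpr ?_) hK
  rintro _ ⟨x, hx, ξ, rfl⟩
  exact h x hx ξ

variable {σ ρ}

/-- Two bounded operators agree on `G_n` if they agree on the `x ⊗ ξ` with `x ∈ A_n`. -/
theorem eq_of_mem_gradedPart {E : Type*} [NormedAddCommGroup E] [NormedSpace ℂ E] {n : ℤ}
    {S T : LiftedSpace σ ρ →L[ℂ] E} (h : ∀ x ∈ σ.spectralSubspace n, ∀ ξ,
      S (simpleTensor σ ρ x ξ) = T (simpleTensor σ ρ x ξ)) {g : LiftedSpace σ ρ}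
    (hg : g ∈ gradedPart σ ρ n) : S g = T g := by
  have h1 : gradedPart σ ρ n ≤ LinearMap.eqLocus S.toLinearMap T.toLinearMap :=
    gradedPart_le σ ρ (isClosed_eq S.continuous T.continuous) h
  exact h1 hg

/-- The frame expansion of the elements of `G_n`. -/
theorem sum_creation_adjoint {n : ℤ} {k : ℕ} {ζ : Fin k → A}
    (hmem : ∀ j, ζ j ∈ σ.spectralSubspace n) (hζ : ∑ j, ζ j * star (ζ j) = 1)
    {g : LiftedSpace σ ρ} (hg : g ∈ gradedPart σ ρ n) :
    ∑ j, creation σ ρ (ζ j) ((creation σ ρ (ζ j)).adjoint g) = g := by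
  have h := eq_of_mem_gradedPart (S := ∑ j, creation σ ρ (ζ j) ∘L (creation σ ρ (ζ j)).adjoint)
    (T := ContinuousLinearMap.id ℂ _) (fun x hx ξ => by
      have h1 : ∀ j, creation σ ρ (ζ j) ((creation σ ρ (ζ j)).adjoint (simpleTensor σ ρ x ξ)) =
          leftAction σ ρ (ζ j * star (ζ j)) (simpleTensor σ ρ x ξ) := fun j => by
        rw [adjoint_creation_simpleTensor, creation_apply, ← simpleTensor_mul_fixed,
          σ.condExpₗ_of_mem (σ.star_mul_mem_fixedAlgebra (hmem j) hx), leftAction_simpleTensor,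
          mul_assoc]
      simp only [sum_apply, ContinuousLinearMap.comp_apply, h1]
      rw [← sum_apply, ← map_sum, hζ, map_one]; rfl) hg
  simpa [sum_apply] using h

/-- The subspaces `G_n` and `G_m` are orthogonal for `n ≠ m`. -/
theorem inner_eq_zero_of_ne {n m : ℤ} (hnm : n ≠ m) {g g' : LiftedSpace σ ρ}
    (hg : g ∈ gradedPart σ ρ n) (hg' : g' ∈ gradedPart σ ρ m) : ⟪g, g'⟫_ℂ = 0 := by
  have h1 : ∀ x ∈ σ.spectralSubspace n, ∀ ξ, ⟪simpleTensor σ ρ x ξ, g'⟫_ℂ = 0 := fun x hx ξ => by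
    refine eq_of_mem_gradedPart (S := innerSL ℂ (simpleTensor σ ρ x ξ)) (T := 0) ?_ hg'
    intro y hy η
    rw [innerSL_apply_apply, inner_simpleTensor, σ.condExpₗ_star_mul_of_ne hnm hx hy]
    simp
  have h2 : ⟪g', g⟫_ℂ = 0 := by
    refine eq_of_mem_gradedPart (S := innerSL ℂ g') (T := 0) ?_ hg
    intro x hx ξ
    rw [innerSL_apply_apply, ← inner_conj_symm, h1 x hx ξ]
    simp
  rw [← inner_conj_symm, h2, map_zero]

variable (σ ρ) in
theorem orthogonalFamily_gradedPart : OrthogonalFamily ℂ (fun n => gradedPart σ ρ n)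
    fun n => (gradedPart σ ρ n).subtypeₗᵢ :=
  fun _ _ hnm g g' => inner_eq_zero_of_ne hnm g.2 g'.2

theorem leftAction_mem_gradedPart {n m : ℤ} {a : A} (ha : a ∈ σ.spectralSubspace n)
    {g : LiftedSpace σ ρ} (hg : g ∈ gradedPart σ ρ m) :
    leftAction σ ρ a g ∈ gradedPart σ ρ (n + m) := by
  have h : gradedPart σ ρ m ≤ (gradedPart σ ρ (n + m)).comap (leftAction σ ρ a).toLinearMap := by
    refine gradedPart_le σ ρ ((isClosed_gradedPart σ ρ _).preimage (leftAction σ ρ a).continuous) ?_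
    intro x hx ξ
    change leftAction σ ρ a (simpleTensor σ ρ x ξ) ∈ gradedPart σ ρ (n + m)
    rw [leftAction_simpleTensor]
    exact simpleTensor_mem_gradedPart σ ρ (σ.mul_mem_spectralSubspace ha hx) ξ
  exact h hg

/-- The representation of `A` on `G` is faithful, because `ρ` and the expectation are. -/
theorem leftAction_injective (hρ : Function.Injective ρ) :
    Function.Injective (leftAction σ ρ) := by
  rw [injective_iff_map_eq_zero]
  intro a ha
  apply σ.eq_zero_of_condExpₗ_star_mul_self
  rw [← map_eq_zero_iff ρ hρ]
  refine ContinuousLinearMap.ext fun ξ => ext_inner_left ℂ fun η => ?_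
  rw [← inner_simpleTensor]
  have : simpleTensor σ ρ a ξ = 0 := by
    rw [← mul_one a, ← leftAction_simpleTensor, ha]; rfl
  rw [this, inner_zero_right]
  simp

end Graded

/-! ### The isometries into `H` -/

section Standing

variable {A : Type*} [CStarAlgebra A] {σ : CircleAction A} {𝒜 : StarSubalgebra ℂ A}
variable {H₀ : Type*} [NormedAddCommGroup H₀] [InnerProductSpace ℂ H₀] [CompleteSpace H₀]
variable {H : Type*} [NormedAddCommGroup H] [InnerProductSpace ℂ H] [CompleteSpace H]

/-- The standing assumptions: a dense subalgebra `𝒜`, a Lipschitz triple on its part of degree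
zero, and the data of the twisted setting on `H`. -/
structure StandingAssumptions (ρ : σ.fixedAlgebra →⋆ₐ[ℂ] (H₀ →L[ℂ] H₀)) (D₀ : H₀ →ₗ.[ℂ] H₀)
    (δ₀ : coreFixed σ 𝒜 → (H₀ →L[ℂ] H₀)) (ι : H₀ →ₗᵢ[ℂ] H) (φ : A →⋆ₐ[ℂ] (H →L[ℂ] H))
    (δ : 𝒜 →ₗ[ℂ] (H →L[ℂ] H)) (μ : ℝ) : Prop where
  dense : Dense (𝒜 : Set A)
  triple : IsLipschitzTriple (coreFixed σ 𝒜) ρ D₀ δ₀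
  exp : ExponentialAssumption ρ δ₀ ι φ δ μ

variable {ρ : σ.fixedAlgebra →⋆ₐ[ℂ] (H₀ →L[ℂ] H₀)} {D₀ : H₀ →ₗ.[ℂ] H₀}
  {δ₀ : coreFixed σ 𝒜 → (H₀ →L[ℂ] H₀)}
variable {ι : H₀ →ₗᵢ[ℂ] H} {φ : A →⋆ₐ[ℂ] (H →L[ℂ] H)} {δ : 𝒜 →ₗ[ℂ] (H →L[ℂ] H)} {μ : ℝ}

namespace StandingAssumptions

variable (h : StandingAssumptions ρ D₀ δ₀ ι φ δ μ)
include h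

/-- There are frames of all the `A_n`, with elements in `𝒜_n`. -/
theorem exists_frame (n : ℤ) : ∃ (k : ℕ) (ζ : Fin k → coreGraded σ 𝒜 n),
    ∑ j, (ζ j : A) * star (ζ j : A) = 1 := by
  obtain ⟨k, ζ, hζ⟩ := h.exp.exists_vanishingFrame n
  exact ⟨k, ζ, h.exp.sum_frame_mul_star hζ⟩

open scoped CStarAlgebra in
/-- The relation between `φ` and `ρ` extends by continuity from `𝒜_0` to `A_0`. -/
theorem rep_fixed {a : A} (ha : a ∈ σ.fixedAlgebra) (ξ : H₀) :
    φ a (ι ξ) = ι (ρ ⟨a, ha⟩ ξ) := by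
  have hc1 : Continuous fun a : σ.fixedAlgebra => φ a (ι ξ) := by
    have hc : Continuous φ := map_continuous φ
    fun_prop
  have hc2 : Continuous fun a : σ.fixedAlgebra => ι (ρ a ξ) := by
    have hc : Continuous ρ := map_continuous ρ
    have := ι.continuous
    fun_prop
  have := Continuous.ext_on h.triple.dense hc1 hc2
    (fun a ha => h.exp.rep_restrict ⟨a, ha⟩ a.2 ξ)
  exact congrFun this ⟨a, ha⟩

/-- A bounded operator on `G` is determined by its values on the `x ⊗ ξ` with `x` in `𝒜_n` and
`ξ` in the domain of `D₀`, because of the frame expansion. -/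
theorem lifted_ext_core {E : Type*} [NormedAddCommGroup E] [NormedSpace ℂ E]
    {S T : LiftedSpace σ ρ →L[ℂ] E} (hST : ∀ (n : ℤ), ∀ x ∈ coreGraded σ 𝒜 n, ∀ ξ ∈ D₀.domain,
      S (simpleTensor σ ρ x ξ) = T (simpleTensor σ ρ x ξ)) : S = T := by
  have h1 : ∀ n, ∀ x ∈ coreGraded σ 𝒜 n, ∀ ξ,
      S (simpleTensor σ ρ x ξ) = T (simpleTensor σ ρ x ξ) := fun n x hx ξ => by
    have := Continuous.ext_on h.triple.selfAdjoint.dense_domain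
      (S ∘L creation σ ρ x).continuous (T ∘L creation σ ρ x).continuous
      (fun ξ hξ => hST n x hx ξ hξ)
    exact congrFun this ξ
  refine lifted_ext σ ρ fun a ξ => ?_
  have hc := continuous_simpleTensor_left σ ρ ξ
  refine congrFun (Continuous.ext_on h.dense (S.continuous.comp hc) (T.continuous.comp hc) ?_) a
  intro a ha
  refine homogeneous_induction h.exp.generated (p := fun a =>
    S (simpleTensor σ ρ a ξ) = T (simpleTensor σ ρ a ξ)) (fun n a ha => h1 n a ⟨a.2, ha⟩ ξ) ?_ ⟨a, ha⟩
  intro a b hTa hTb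
  rw [AddMemClass.coe_add, simpleTensor_add_left, map_add, map_add, hTa, hTb]

theorem ext_inner_core {g g' : LiftedSpace σ ρ} (hg : ∀ (n : ℤ), ∀ x ∈ coreGraded σ 𝒜 n,
    ∀ ξ ∈ D₀.domain, ⟪simpleTensor σ ρ x ξ, g⟫_ℂ = ⟪simpleTensor σ ρ x ξ, g'⟫_ℂ) : g = g' := by
  have h1 : innerSL ℂ g = innerSL ℂ g' := h.lifted_ext_core fun n x hx ξ hξ => by
    rw [innerSL_apply_apply, innerSL_apply_apply, ← inner_conj_symm, hg n x hx ξ hξ,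
      inner_conj_symm]
  exact ext_inner_right ℂ fun v => by
    simpa using congrArg (fun T : LiftedSpace σ ρ →L[ℂ] ℂ => T v) h1

/-- Two bounded operators agree on `G_n` if they agree on the `x ⊗ ξ` with `x` in `𝒜_n` and
`ξ` in the domain of `D₀`. -/
theorem eq_of_mem_gradedPart_core {E : Type*} [NormedAddCommGroup E] [NormedSpace ℂ E] {n : ℤ}
    {S T : LiftedSpace σ ρ →L[ℂ] E} (hST : ∀ x ∈ coreGraded σ 𝒜 n, ∀ ξ ∈ D₀.domain,
      S (simpleTensor σ ρ x ξ) = T (simpleTensor σ ρ x ξ)) {g : LiftedSpace σ ρ}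
    (hg : g ∈ gradedPart σ ρ n) : S g = T g := by
  obtain ⟨k, ζ, hζ⟩ := h.exists_frame n
  rw [← sum_creation_adjoint (fun j => (ζ j).2.2) hζ hg, map_sum, map_sum]
  refine Finset.sum_congr rfl fun j _ => ?_
  have := Continuous.ext_on h.triple.selfAdjoint.dense_domain
    (S ∘L creation σ ρ (ζ j)).continuous (T ∘L creation σ ρ (ζ j)).continuous
    (fun ξ hξ => hST (ζ j) (ζ j).2 ξ hξ)
  exact congrFun this _

theorem mem_closed_of_core {K : Submodule ℂ (LiftedSpace σ ρ)}
    (hK : IsClosed (K : Set (LiftedSpace σ ρ)))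
    (hc : ∀ (n : ℤ), ∀ x ∈ coreGraded σ 𝒜 n, ∀ ξ ∈ D₀.domain, simpleTensor σ ρ x ξ ∈ K) :
    K = ⊤ := by
  rw [← hK.submodule_topologicalClosure_eq, Submodule.topologicalClosure_eq_top_iff,
    Submodule.eq_bot_iff]
  intro v hv
  refine h.ext_inner_core fun n x hx ξ hξ => ?_
  rw [hv _ (hc n x hx ξ hξ), inner_zero_right]

/-- Each `G_n` is a finite sum of images of `H₀`, so that `G` is separable. -/
theorem separableSpace_lifted : TopologicalSpace.SeparableSpace (LiftedSpace σ ρ) := by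
  have := h.triple.separable
  choose k ζ hζ using h.exists_frame
  set s : Set (LiftedSpace σ ρ) := ⋃ n, ⋃ j, Set.range (creation σ ρ (ζ n j : A)) with hs
  have hsep : TopologicalSpace.IsSeparable s :=
    .iUnion fun n => .iUnion fun j =>
      TopologicalSpace.isSeparable_range (creation σ ρ (ζ n j : A)).continuous
  rw [← TopologicalSpace.isSeparable_univ_iff]
  have htop : (Submodule.span ℂ s).topologicalClosure = ⊤ := by
    refine h.mem_closed_of_core (Submodule.isClosed_topologicalClosure _) fun n x hx ξ _ => ?_
    apply Submodule.le_topologicalClosure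
    rw [← sum_creation_adjoint (fun j => (ζ n j).2.2) (hζ n)
      (simpleTensor_mem_gradedPart σ ρ hx.2 ξ)]
    refine Submodule.sum_mem _ fun j _ => Submodule.subset_span ?_
    exact Set.mem_iUnion.mpr ⟨n, Set.mem_iUnion.mpr ⟨j, Set.mem_range_self _⟩⟩
  have hcl := hsep.span (R := ℂ) |>.closure
  rwa [← Submodule.topologicalClosure_coe, htop] at hcl

end StandingAssumptions

/-- The operators `U_n : G → H` with `U_n (x ⊗ ξ) = φ(x) ξ` for `x ∈ A_n` which vanish on
the `G_m` with `m ≠ n`. -/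
structure IsTransport (ρ : σ.fixedAlgebra →⋆ₐ[ℂ] (H₀ →L[ℂ] H₀)) (ι : H₀ →ₗᵢ[ℂ] H)
    (φ : A →⋆ₐ[ℂ] (H →L[ℂ] H)) (U : ℤ → LiftedSpace σ ρ →L[ℂ] H) : Prop where
  apply_simpleTensor : ∀ n, ∀ x ∈ σ.spectralSubspace n, ∀ ξ,
    U n (simpleTensor σ ρ x ξ) = φ x (ι ξ)
  apply_of_ne : ∀ n m, n ≠ m → ∀ g ∈ gradedPart σ ρ m, U n g = 0

/-- In terms of a frame of `A_n`, the operator `U_n` is given by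
`U_n η = ∑ φ(ζ_j) (θ_{ζ_j}^* η)`. -/
theorem StandingAssumptions.exists_isTransport (h : StandingAssumptions ρ D₀ δ₀ ι φ δ μ) :
    ∃ U : ℤ → LiftedSpace σ ρ →L[ℂ] H, IsTransport ρ ι φ U := by
  choose k ζ hζ using h.exists_frame
  refine ⟨fun n => ∑ j, φ (ζ n j) ∘L ι.toContinuousLinearMap ∘L
    (creation σ ρ (ζ n j : A)).adjoint, ⟨fun n x hx ξ => ?_, fun n m hnm g hg => ?_⟩⟩
  · have h1 : ∀ j, φ (ζ n j) (ι ((creation σ ρ (ζ n j : A)).adjoint (simpleTensor σ ρ x ξ))) =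
        φ (ζ n j * star (ζ n j : A)) (φ x (ι ξ)) := fun j => by
      have hm := σ.star_mul_mem_fixedAlgebra (ζ n j).2.2 hx
      rw [adjoint_creation_simpleTensor, σ.condExpₗ_of_mem hm, ← h.rep_fixed hm, map_mul, map_mul]
      rfl
    simp only [sum_apply, ContinuousLinearMap.comp_apply,
      LinearIsometry.coe_toContinuousLinearMap, h1]
    rw [← sum_apply, ← map_sum, hζ, map_one]; rfl
  · have h1 : ∀ j, (creation σ ρ (ζ n j : A)).adjoint g = 0 := fun j => by
      refine eq_of_mem_gradedPart (T := 0) (fun x hx ξ => ?_) hg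
      rw [adjoint_creation_simpleTensor, σ.condExpₗ_star_mul_of_ne hnm (ζ n j).2.2 hx]
      simp
    simp [sum_apply, h1]

namespace IsTransport

variable {U : ℤ → LiftedSpace σ ρ →L[ℂ] H} (hU : IsTransport ρ ι φ U)
  (h : StandingAssumptions ρ D₀ δ₀ ι φ δ μ)
include hU h

/-- The operator `U_n^* U_n` is the projection onto `G_n`. -/
theorem adjoint_apply_self {n : ℤ} {g : LiftedSpace σ ρ} (hg : g ∈ gradedPart σ ρ n) :
    (U n).adjoint (U n g) = g := by
  refine eq_of_mem_gradedPart (S := (U n).adjoint ∘L U n) (T := ContinuousLinearMap.id ℂ _)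
    (fun x hx ξ => ?_) hg
  refine h.ext_inner_core fun m y hy η _ => ?_
  rw [ContinuousLinearMap.comp_apply, ContinuousLinearMap.adjoint_inner_right,
    ContinuousLinearMap.id_apply]
  by_cases hnm : n = m
  · subst hnm
    have hm := σ.star_mul_mem_fixedAlgebra hy.2 hx
    rw [hU.apply_simpleTensor n x hx, hU.apply_simpleTensor n y hy.2, inner_simpleTensor,
      σ.condExpₗ_of_mem hm, ← ContinuousLinearMap.adjoint_inner_right,
      ← ContinuousLinearMap.star_eq_adjoint, ← map_star, ← mul_apply_eq_comp, ← map_mul,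
      h.rep_fixed hm, ι.inner_map_map]
  · rw [hU.apply_of_ne n m hnm _ (simpleTensor_mem_gradedPart σ ρ hy.2 η), inner_zero_left,
      inner_eq_zero_of_ne (Ne.symm hnm) (simpleTensor_mem_gradedPart σ ρ hy.2 η)
        (simpleTensor_mem_gradedPart σ ρ hx ξ)]

theorem norm_apply {n : ℤ} {g : LiftedSpace σ ρ} (hg : g ∈ gradedPart σ ρ n) :
    ‖U n g‖ = ‖g‖ := by
  rw [← sq_eq_sq₀ (norm_nonneg _) (norm_nonneg _), norm_sq_eq_re_inner (𝕜 := ℂ),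
    ← ContinuousLinearMap.adjoint_inner_right, hU.adjoint_apply_self h hg,
    ← norm_sq_eq_re_inner (𝕜 := ℂ)]

theorem adjoint_mem (n : ℤ) (v : H) : (U n).adjoint v ∈ gradedPart σ ρ n := by
  have hc : IsClosed (gradedPart σ ρ n : Set (LiftedSpace σ ρ)) := isClosed_gradedPart σ ρ n
  have : CompleteSpace (gradedPart σ ρ n) := hc.completeSpace_coe
  rw [← Submodule.orthogonal_orthogonal (gradedPart σ ρ n)]
  intro w hw
  rw [ContinuousLinearMap.adjoint_inner_right]
  suffices hz : U n w = 0 by rw [hz, inner_zero_left]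
  -- `‖U_n w‖² = ⟪w, U_n^* U_n w⟫`, and `U_n^* U_n w` lies in `G_n` for `w` in the dense subspace
  have hP : ∀ w, (U n).adjoint (U n w) ∈ gradedPart σ ρ n := by
    have htop : (gradedPart σ ρ n).comap ((U n).adjoint ∘L U n).toLinearMap = ⊤ := by
      refine h.mem_closed_of_core (hc.preimage ((U n).adjoint ∘L U n).continuous) ?_
      intro m x hx ξ _
      have hxm := simpleTensor_mem_gradedPart σ ρ hx.2 ξ
      change (U n).adjoint (U n (simpleTensor σ ρ x ξ)) ∈ gradedPart σ ρ n
      by_cases hnm : n = m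
      · subst hnm
        rwa [hU.adjoint_apply_self h hxm]
      · rw [hU.apply_of_ne n m hnm _ hxm, map_zero]
        exact Submodule.zero_mem _
    intro w
    have : w ∈ (gradedPart σ ρ n).comap ((U n).adjoint ∘L U n).toLinearMap := htop ▸ trivial
    exact this
  have h0 : ⟪U n w, U n w⟫_ℂ = 0 := by
    rw [← ContinuousLinearMap.adjoint_inner_left]
    exact hw _ (hP w)
  exact inner_self_eq_zero.mp h0

/-- Bessel's inequality for the decomposition of `G` into the `G_n`. -/
theorem sum_norm_sq_le (F : Finset ℤ) (g : LiftedSpace σ ρ) :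
    ∑ n ∈ F, ‖U n g‖ ^ 2 ≤ ‖g‖ ^ 2 := by
  set P : ℤ → LiftedSpace σ ρ := fun n => (U n).adjoint (U n g) with hP
  have hmem : ∀ n, P n ∈ gradedPart σ ρ n := fun n => hU.adjoint_mem h n _
  have hn : ∀ n, ‖U n g‖ ^ 2 = ‖P n‖ ^ 2 := fun n => by
    rw [norm_sq_eq_re_inner (𝕜 := ℂ) (P n), hP]
    simp only
    rw [ContinuousLinearMap.adjoint_inner_left, ← ContinuousLinearMap.adjoint_inner_right,
      hU.adjoint_apply_self h (hmem n), ContinuousLinearMap.adjoint_inner_right,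
      ← norm_sq_eq_re_inner (𝕜 := ℂ)]
  have h1 : ‖∑ n ∈ F, P n‖ ^ 2 = ∑ n ∈ F, ‖P n‖ ^ 2 :=
    (orthogonalFamily_gradedPart σ ρ).norm_sum (fun n => ⟨P n, hmem n⟩) F
  have h2 : ∑ n ∈ F, ‖U n g‖ ^ 2 = RCLike.re ⟪g, ∑ n ∈ F, P n⟫_ℂ := by
    rw [inner_sum, map_sum]
    refine Finset.sum_congr rfl fun n _ => ?_
    rw [ContinuousLinearMap.adjoint_inner_right, ← norm_sq_eq_re_inner (𝕜 := ℂ)]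
  have h3 : RCLike.re ⟪g, ∑ n ∈ F, P n⟫_ℂ ≤ ‖g‖ * ‖∑ n ∈ F, P n‖ := re_inner_le_norm _ _
  have h4 : ∑ n ∈ F, ‖U n g‖ ^ 2 = ‖∑ n ∈ F, P n‖ ^ 2 := by
    rw [h1]; exact Finset.sum_congr rfl fun n _ => hn n
  rw [← h2, h4] at h3
  rw [h4]
  have := norm_nonneg (∑ n ∈ F, P n)
  have := norm_nonneg g
  nlinarith

/-- Each vector of `G` is the sum of its components. -/
theorem hasSum_adjoint_apply (g : LiftedSpace σ ρ) :
    HasSum (fun n => (U n).adjoint (U n g)) g := by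
  have hs : Summable fun n => (U n).adjoint (U n g) := by
    refine ((orthogonalFamily_gradedPart σ ρ).summable_iff_norm_sq_summable
      (fun n => ⟨(U n).adjoint (U n g), hU.adjoint_mem h n _⟩)).mpr ?_
    refine summable_of_sum_le (c := ‖g‖ ^ 2) (fun n => by positivity) fun F => ?_
    refine le_trans (Finset.sum_le_sum fun n _ => ?_) (hU.sum_norm_sq_le h F g)
    have : ‖(U n).adjoint (U n g)‖ = ‖U n ((U n).adjoint (U n g))‖ :=
      (hU.norm_apply h (hU.adjoint_mem h n _)).symm
    have h5 : U n ((U n).adjoint (U n g)) = U n g := by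
      have h6 := hU.adjoint_apply_self h (hU.adjoint_mem h n (U n g))
      have h7 : U n ((U n).adjoint (U n g) - g) = 0 := by
        rw [← inner_self_eq_zero (𝕜 := ℂ), ← ContinuousLinearMap.adjoint_inner_right, map_sub,
          map_sub, h6, sub_self, inner_zero_right]
      rwa [map_sub, sub_eq_zero] at h7
    change ‖(U n).adjoint (U n g)‖ ^ 2 ≤ _
    rw [this, h5]
  convert hs.hasSum using 1
  refine h.ext_inner_core fun m x hx ξ _ => ?_
  have hxm := simpleTensor_mem_gradedPart σ ρ hx.2 ξ
  have h1 := hs.hasSum.mapL (innerSL ℂ (simpleTensor σ ρ x ξ))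
  have h2 : ∀ n, n ≠ m → innerSL ℂ (simpleTensor σ ρ x ξ) ((U n).adjoint (U n g)) = 0 :=
    fun n hn => inner_eq_zero_of_ne hn.symm hxm (hU.adjoint_mem h n _)
  have h3 := h1.unique (hasSum_single m h2)
  rw [innerSL_apply_apply, innerSL_apply_apply] at h3
  rw [h3, ContinuousLinearMap.adjoint_inner_right, ← ContinuousLinearMap.adjoint_inner_left,
    hU.adjoint_apply_self h hxm]

end IsTransport

end Standing

/-! ### Uniqueness of analytic extensions -/

section Strip

/-- A function which vanishes on the real line vanishes at the centre of each square with one side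
on the real line, by the maximum principle for the product of its four rotated copies. -/
theorem eq_zero_of_square {f : ℂ → ℂ} {z₀ : ℂ} {c : ℝ} (hc : 0 < c) (hz : z₀.im = c)
    (hf : ContinuousOn f {z | 0 ≤ z.im ∧ z.im ≤ 2 * c})
    (hd : DifferentiableOn ℂ f {z | 0 < z.im ∧ z.im < 2 * c}) (h0 : ∀ s : ℝ, f s = 0) :
    f z₀ = 0 := by
  have hreal : ∀ z : ℂ, z.im = 0 → f z = 0 := fun z hz => by
    rw [← h0 z.re]; congr 1; exact Complex.ext (by simp) (by simp [hz])
  set Q : Set ℂ := Set.Ioo (-c) c ×ℂ Set.Ioo (-c) c with hQ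
  have hne : -c ≠ c := by linarith
  have hcl : closure Q = Set.Icc (-c) c ×ℂ Set.Icc (-c) c := by
    rw [hQ, Complex.closure_reProdIm, closure_Ioo hne]
  have hrot : ∀ u : ℂ, (u = 1 ∨ u = Complex.I ∨ u = -1 ∨ u = -Complex.I) →
      DiffContOnCl ℂ (fun w => f (z₀ + u * w)) Q := by
    intro u hu
    refine ⟨hd.comp (by fun_prop) fun w hw => ?_, hf.comp (by fun_prop) fun w hw => ?_⟩
    · rw [hQ, Complex.mem_reProdIm] at hw
      obtain ⟨⟨h1, h2⟩, h3, h4⟩ := hw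
      rcases hu with rfl | rfl | rfl | rfl <;>
        simp [hz] <;> constructor <;> linarith
    · rw [hcl, Complex.mem_reProdIm] at hw
      obtain ⟨⟨h1, h2⟩, h3, h4⟩ := hw
      rcases hu with rfl | rfl | rfl | rfl <;>
        simp [hz] <;> constructor <;> linarith
  have hF : DiffContOnCl ℂ (fun w => (f (z₀ + 1 * w) * f (z₀ + Complex.I * w)) *
      (f (z₀ + -1 * w) * f (z₀ + -Complex.I * w))) Q := by
    have h1 := hrot 1 (by simp)
    have h2 := hrot Complex.I (by simp)
    have h3 := hrot (-1) (by simp)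
    have h4 := hrot (-Complex.I) (by simp)
    exact ⟨(h1.1.mul h2.1).mul (h3.1.mul h4.1), (h1.2.mul h2.2).mul (h3.2.mul h4.2)⟩
  have hb : Bornology.IsBounded Q :=
    (Metric.isBounded_Ioo _ _).reProdIm (Metric.isBounded_Ioo _ _)
  have hfr : ∀ w ∈ frontier Q, ‖(f (z₀ + 1 * w) * f (z₀ + Complex.I * w)) *
      (f (z₀ + -1 * w) * f (z₀ + -Complex.I * w))‖ ≤ 0 := by
    intro w hw
    rw [hQ, Complex.frontier_reProdIm, frontier_Ioo (by linarith)] at hw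
    rw [norm_le_zero_iff]
    rcases hw with ⟨-, hw⟩ | ⟨hw, -⟩
    · rcases hw with hw | hw
      · rw [hreal (z₀ + 1 * w) (by simp [hz, hw])]; ring
      · rw [hreal (z₀ + -1 * w) (by simp [hz, Set.mem_singleton_iff.mp hw])]; ring
    · rcases hw with hw | hw
      · rw [hreal (z₀ + Complex.I * w) (by simp [hz, hw])]; ring
      · rw [hreal (z₀ + -Complex.I * w) (by simp [hz, Set.mem_singleton_iff.mp hw])]; ring
  have h := Complex.norm_le_of_forall_mem_frontier_norm_le hb hF hfr (z := 0) (subset_closure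
    (by rw [hQ, Complex.mem_reProdIm]; simp [hc]))
  rw [norm_le_zero_iff] at h
  simpa using h

variable {E : Type*} [NormedAddCommGroup E] [NormedSpace ℂ E] [CompleteSpace E]

theorem strip_of_nonneg {r : ℝ} (hr : 0 ≤ r) : strip r = Complex.im ⁻¹' Set.Icc 0 r := by
  rw [strip, Set.uIcc_of_le hr]; rfl

theorem eqOn_zero_strip_of_pos {r : ℝ} (hr : 0 < r) {f : ℂ → E} (hf : ContinuousOn f (strip r))
    (hd : DifferentiableOn ℂ f (interior (strip r))) (h0 : ∀ s : ℝ, f s = 0) :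
    Set.EqOn f 0 (strip r) := by
  rw [strip_of_nonneg hr.le] at *
  rw [Complex.interior_preimage_im, interior_Icc] at hd
  have hlow : ∀ z : ℂ, 0 < z.im → 2 * z.im ≤ r → f z = 0 := by
    intro z hz hzr
    rw [SeparatingDual.eq_zero_iff_forall_dual_eq_zero (R := ℂ)]
    intro l
    refine eq_zero_of_square (f := fun w => l (f w)) hz rfl ?_ ?_ (fun s => by rw [h0, map_zero])
    · exact l.continuous.comp_continuousOn (hf.mono fun w hw => ⟨hw.1, hw.2.trans hzr⟩)
    · exact l.differentiable.comp_differentiableOn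
        (hd.mono fun w hw => ⟨hw.1, hw.2.trans_le hzr⟩)
  have hopen : IsOpen (Complex.im ⁻¹' Set.Ioo 0 r) := isOpen_Ioo.preimage Complex.continuous_im
  have hconn : IsPreconnected (Complex.im ⁻¹' Set.Ioo 0 r) :=
    ((convex_Ioo 0 r).linear_preimage Complex.imLm).isPreconnected
  have hmem : Complex.I * (r / 4 : ℝ) ∈ Complex.im ⁻¹' Set.Ioo 0 r := by
    simp; constructor <;> linarith
  have hint : Set.EqOn f 0 (Complex.im ⁻¹' Set.Ioo 0 r) := by
    refine (hd.analyticOnNhd hopen).eqOn_zero_of_preconnected_of_eventuallyEq_zero hconn hmem ?_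
    have hnhds : Complex.im ⁻¹' Set.Ioo 0 (r / 2) ∈ nhds (Complex.I * (r / 4 : ℝ)) := by
      refine (isOpen_Ioo.preimage Complex.continuous_im).mem_nhds ?_
      simp; constructor <;> linarith
    filter_upwards [hnhds] with z hz
    exact hlow z hz.1 (by linarith [hz.2])
  refine hint.of_subset_closure hf continuousOn_const (Set.preimage_mono Set.Ioo_subset_Icc_self) ?_
  rw [Complex.closure_preimage_im, closure_Ioo hr.ne]

theorem neg_mem_strip_neg {r : ℝ} {z : ℂ} : -z ∈ strip (-r) ↔ z ∈ strip r := by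
  simp only [strip, Set.mem_ofPred_eq, Complex.neg_im, Set.mem_uIcc]
  constructor <;> rintro (h | h) <;> [right; left; right; left] <;>
    constructor <;> linarith [h.1, h.2]

theorem eqOn_zero_strip {r : ℝ} {f : ℂ → E} (hf : ContinuousOn f (strip r))
    (hd : DifferentiableOn ℂ f (interior (strip r))) (h0 : ∀ s : ℝ, f s = 0) :
    Set.EqOn f 0 (strip r) := by
  rcases lt_trichotomy r 0 with hr | rfl | hr
  · have hpre : Neg.neg ⁻¹' strip r = strip (-r) := by
      ext z; rw [Set.mem_preimage, ← neg_mem_strip_neg, neg_neg]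
    have hmap : Set.MapsTo Neg.neg (strip (-r)) (strip r) := fun z hz => by
      rwa [← hpre] at hz
    have hmap' : Set.MapsTo Neg.neg (interior (strip (-r))) (interior (strip r)) := fun z hz => by
      have := (Homeomorph.neg ℂ).preimage_interior (strip r)
      simp only [Homeomorph.coe_neg] at this
      rw [← hpre, ← this] at hz
      exact hz
    have h := eqOn_zero_strip_of_pos (f := fun z => f (-z)) (neg_pos.mpr hr)
      (hf.comp continuous_neg.continuousOn hmap) (hd.comp differentiable_neg.differentiableOn hmap')
      (fun s => by rw [← Complex.ofReal_neg, h0])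
    intro z hz
    have := h (neg_mem_strip_neg.mpr hz)
    simpa using this
  · intro z hz
    have hz0 : z.im = 0 := by simpa [strip] using hz
    rw [Pi.zero_apply, ← h0 z.re]; congr 1; exact Complex.ext (by simp) (by simp [hz0])
  · exact eqOn_zero_strip_of_pos hr hf hd h0

end Strip

section AnalyticAut

variable {H : Type*} [NormedAddCommGroup H] [InnerProductSpace ℂ H] [CompleteSpace H]
variable {V : ℝ → (H →L[ℂ] H)} {r : ℝ} {T T' : H →L[ℂ] H} {f g : ℂ → (H →L[ℂ] H)}

namespace IsAnalyticExtension

theorem eqOn (hf : IsAnalyticExtension V r T f) (hg : IsAnalyticExtension V r T g) :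
    Set.EqOn f g (strip r) := fun z hz => by
  have := eqOn_zero_strip (hf.continuousOn.sub hg.continuousOn)
    (hf.holomorphic.sub hg.holomorphic) (fun s => by simp [hf.apply_real, hg.apply_real]) hz
  simpa [sub_eq_zero] using this

theorem analyticAut_eq {z : ℂ} (hf : IsAnalyticExtension V z.im T f) : analyticAut V z T = f z := by
  have hT : IsAnalyticOperator V z.im T := ⟨f, hf⟩
  rw [analyticAut, dif_pos hT]
  exact hT.choose_spec.eqOn hf Set.right_mem_uIcc

theorem add (hf : IsAnalyticExtension V r T f) (hg : IsAnalyticExtension V r T' g) :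
    IsAnalyticExtension V r (T + T') (f + g) :=
  ⟨hf.continuousOn.add hg.continuousOn, hf.holomorphic.add hg.holomorphic, fun s => by
    rw [Pi.add_apply, hf.apply_real, hg.apply_real, mul_add, add_mul]⟩

theorem smul (c : ℂ) (hf : IsAnalyticExtension V r T f) :
    IsAnalyticExtension V r (c • T) (c • f) :=
  ⟨hf.continuousOn.const_smul c, hf.holomorphic.const_smul c, fun s => by
    rw [Pi.smul_apply, hf.apply_real, mul_smul_comm, smul_mul_assoc]⟩

theorem mul (hV : IsUnitaryGroup V) (hf : IsAnalyticExtension V r T f)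
    (hg : IsAnalyticExtension V r T' g) : IsAnalyticExtension V r (T * T') (f * g) :=
  ⟨hf.continuousOn.mul hg.continuousOn, hf.holomorphic.mul hg.holomorphic, fun s => by
    have h1 : star (V s) * V s = 1 := (Unitary.mem_iff.mp (hV.mem_unitary s)).1
    rw [Pi.mul_apply, hf.apply_real, hg.apply_real]
    calc V s * T * star (V s) * (V s * T' * star (V s))
        = V s * T * (star (V s) * V s) * T' * star (V s) := by simp only [mul_assoc]
      _ = _ := by rw [h1, mul_one]; simp only [mul_assoc]⟩

end IsAnalyticExtension

variable {z : ℂ}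

theorem analyticAut_add (hT : IsAnalyticOperator V z.im T) (hT' : IsAnalyticOperator V z.im T') :
    analyticAut V z (T + T') = analyticAut V z T + analyticAut V z T' := by
  obtain ⟨f, hf⟩ := hT
  obtain ⟨g, hg⟩ := hT'
  rw [(hf.add hg).analyticAut_eq, hf.analyticAut_eq, hg.analyticAut_eq, Pi.add_apply]

theorem analyticAut_smul (c : ℂ) (hT : IsAnalyticOperator V z.im T) :
    analyticAut V z (c • T) = c • analyticAut V z T := by
  obtain ⟨f, hf⟩ := hT
  rw [(hf.smul c).analyticAut_eq, hf.analyticAut_eq, Pi.smul_apply]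

theorem analyticAut_mul (hV : IsUnitaryGroup V) (hT : IsAnalyticOperator V z.im T)
    (hT' : IsAnalyticOperator V z.im T') :
    analyticAut V z (T * T') = analyticAut V z T * analyticAut V z T' := by
  obtain ⟨f, hf⟩ := hT
  obtain ⟨g, hg⟩ := hT'
  rw [(hf.mul hV hg).analyticAut_eq, hf.analyticAut_eq, hg.analyticAut_eq, Pi.mul_apply]

end AnalyticAut

/-! ### The modular group -/

section ModularGroup

variable {A : Type*} [CStarAlgebra A] (σ : CircleAction A)
variable {H₀ : Type*} [NormedAddCommGroup H₀] [InnerProductSpace ℂ H₀] [CompleteSpace H₀]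
variable (ρ : σ.fixedAlgebra →⋆ₐ[ℂ] (H₀ →L[ℂ] H₀))

theorem circleUnitary_one : circleUnitary σ ρ 1 = 1 := lifted_ext σ ρ fun b ξ => by
  rw [circleUnitary_simpleTensor, map_one]; rfl

theorem circleUnitary_mul (z w : Circle) :
    circleUnitary σ ρ (z * w) = circleUnitary σ ρ z * circleUnitary σ ρ w :=
  lifted_ext σ ρ fun b ξ => by
    rw [mul_apply_eq_comp, circleUnitary_simpleTensor, circleUnitary_simpleTensor,
      circleUnitary_simpleTensor, map_mul, StarAlgEquiv.mul_apply]

theorem inner_circleUnitary (z : Circle) (g g' : LiftedSpace σ ρ) :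
    ⟪circleUnitary σ ρ z g, circleUnitary σ ρ z g'⟫_ℂ = ⟪g, g'⟫_ℂ := by
  induction g, g' using UniformSpace.Completion.induction_on₂ with
  | hp => apply isClosed_eq <;> fun_prop
  | ih x y =>
    obtain ⟨x, rfl⟩ := (toPre σ ρ).surjective x
    obtain ⟨y, rfl⟩ := (toPre σ ρ).surjective y
    simp only [circleUnitary, inducedOp_coe, UniformSpace.Completion.inner_coe, inner_toPre,
      form_act]

theorem circleUnitary_mem_unitary (z : Circle) :
    circleUnitary σ ρ z ∈ unitary (LiftedSpace σ ρ →L[ℂ] LiftedSpace σ ρ) := by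
  have h1 : star (circleUnitary σ ρ z) * circleUnitary σ ρ z = 1 := by
    refine ContinuousLinearMap.ext fun g => ext_inner_left ℂ fun g' => ?_
    rw [mul_apply_eq_comp, ContinuousLinearMap.star_eq_adjoint,
      ContinuousLinearMap.adjoint_inner_right, inner_circleUnitary]
    rfl
  have h2 : circleUnitary σ ρ z * circleUnitary σ ρ z⁻¹ = 1 := by
    rw [← circleUnitary_mul, mul_inv_cancel, circleUnitary_one]
  refine Unitary.mem_iff.mpr ⟨h1, ?_⟩
  rwa [left_inv_eq_right_inv h1 h2]

theorem continuous_circleUnitary (g : LiftedSpace σ ρ) :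
    Continuous fun z => circleUnitary σ ρ z g := by
  have hpre : ∀ x : A ⊗[ℂ] H₀,
      Continuous fun z => circleUnitary σ ρ z (toPre σ ρ x : PreTensor σ ρ) := by
    intro x
    induction x with
    | zero =>
      simp only [map_zero, UniformSpace.Completion.coe_zero]
      exact continuous_const
    | add x y hx hy =>
      simp only [map_add, UniformSpace.Completion.coe_add]
      exact hx.add hy
    | tmul a ξ =>
      have : ∀ z, circleUnitary σ ρ z (toPre σ ρ (a ⊗ₜ[ℂ] ξ) : PreTensor σ ρ) =
          simpleTensor σ ρ (σ.toHom z a) ξ := fun z => circleUnitary_simpleTensor σ ρ z a ξ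
      rw [funext this]
      exact (continuous_simpleTensor_left σ ρ ξ).comp (σ.continuous_apply a)
  refine continuous_of_uniform_approx_of_continuous fun u hu => ?_
  obtain ⟨ε, hε, hu⟩ := Metric.mem_uniformity_dist.mp hu
  obtain ⟨x, hx⟩ := (UniformSpace.Completion.denseRange_coe
    (α := PreTensor σ ρ)).exists_dist_lt g hε
  obtain ⟨x, rfl⟩ := (toPre σ ρ).surjective x
  refine ⟨_, hpre x, fun z => hu ?_⟩
  have hn : ∀ v, ‖circleUnitary σ ρ z v‖ = ‖v‖ := fun v => by
    rw [← sq_eq_sq₀ (norm_nonneg _) (norm_nonneg _), norm_sq_eq_re_inner (𝕜 := ℂ),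
      inner_circleUnitary, ← norm_sq_eq_re_inner (𝕜 := ℂ)]
  rwa [dist_eq_norm, ← map_sub, hn, ← dist_eq_norm]

theorem isUnitaryGroup_modularGroup (μ : ℝ) : IsUnitaryGroup (modularGroup σ ρ μ) where
  mem_unitary s := circleUnitary_mem_unitary σ ρ _
  map_zero := by rw [modularGroup, zero_mul, zero_div, Circle.exp_zero, circleUnitary_one]
  map_add s t := by
    simp only [modularGroup]
    rw [← circleUnitary_mul, ← Circle.exp_add, add_mul, add_div]
  continuous_apply g := (continuous_circleUnitary σ ρ g).comp
    (Circle.exp.continuous.comp (by fun_prop : Continuous fun s : ℝ => s * Real.log μ / 2))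

/-- The unitary group implements the action of the circle on `A`. -/
theorem circleUnitary_conj (z : Circle) (a : A) :
    circleUnitary σ ρ z * leftAction σ ρ a * star (circleUnitary σ ρ z) =
      leftAction σ ρ (σ.toHom z a) := by
  have h : circleUnitary σ ρ z * leftAction σ ρ a =
      leftAction σ ρ (σ.toHom z a) * circleUnitary σ ρ z := lifted_ext σ ρ fun b ξ => by
    rw [mul_apply_eq_comp, mul_apply_eq_comp, leftAction_simpleTensor, circleUnitary_simpleTensor,
      circleUnitary_simpleTensor, leftAction_simpleTensor, map_mul]
  rw [h, mul_assoc, (Unitary.mem_iff.mp (circleUnitary_mem_unitary σ ρ z)).2, mul_one]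

variable {σ} {μ : ℝ}

theorem isAnalyticExtension_leftAction (r : ℝ) {n : ℤ} {a : A} (ha : a ∈ σ.spectralSubspace n) :
    IsAnalyticExtension (modularGroup σ ρ μ) r (leftAction σ ρ a)
      (fun z => Complex.exp (Complex.I * z * n * Real.log μ / 2) • leftAction σ ρ a) := by
  have hd : Differentiable ℂ
      (fun z : ℂ => Complex.exp (Complex.I * z * n * Real.log μ / 2) • leftAction σ ρ a) := by
    fun_prop
  refine ⟨hd.continuous.continuousOn, hd.differentiableOn, fun s => ?_⟩
  rw [modularGroup, circleUnitary_conj, ha, map_smul]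
  congr 1
  rw [Circle.coe_exp, ← Complex.exp_int_mul]
  congr 1
  push_cast
  ring

theorem analyticAut_I_leftAction (hμ : 0 < μ) {n : ℤ} {a : A} (ha : a ∈ σ.spectralSubspace n) :
    analyticAut (modularGroup σ ρ μ) Complex.I (leftAction σ ρ a) =
      ((μ ^ (-(n : ℝ) / 2) : ℝ) : ℂ) • leftAction σ ρ a := by
  rw [(isAnalyticExtension_leftAction ρ _ ha).analyticAut_eq, Complex.I_mul_I,
    Real.rpow_def_of_pos hμ]
  push_cast
  congr 2
  ring

theorem analyticAut_neg_I_leftAction (hμ : 0 < μ) {n : ℤ} {a : A}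
    (ha : a ∈ σ.spectralSubspace n) :
    analyticAut (modularGroup σ ρ μ) (-Complex.I) (leftAction σ ρ a) =
      ((μ ^ ((n : ℝ) / 2) : ℝ) : ℂ) • leftAction σ ρ a := by
  rw [(isAnalyticExtension_leftAction ρ _ ha).analyticAut_eq, mul_neg, Complex.I_mul_I,
    Real.rpow_def_of_pos hμ]
  push_cast
  congr 2
  ring

variable {𝒜 : StarSubalgebra ℂ A}

theorem isAnalyticOperator_leftAction
    (hgen : StarAlgebra.adjoin ℂ (coreGraded σ 𝒜 1 : Set A) = 𝒜) (r : ℝ) (a : 𝒜) :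
    IsAnalyticOperator (modularGroup σ ρ μ) r (leftAction σ ρ a) := by
  induction a using homogeneous_induction hgen with
  | hom n a ha => exact ⟨_, isAnalyticExtension_leftAction ρ r ha⟩
  | add a b ha hb =>
    obtain ⟨f, hf⟩ := ha
    obtain ⟨g, hg⟩ := hb
    exact ⟨f + g, by rw [AddMemClass.coe_add, map_add]; exact hf.add hg⟩

theorem star_analyticAut_I (hgen : StarAlgebra.adjoin ℂ (coreGraded σ 𝒜 1 : Set A) = 𝒜)
    (hμ : 0 < μ) (a : 𝒜) :
    star (analyticAut (modularGroup σ ρ μ) Complex.I (leftAction σ ρ a)) =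
      analyticAut (modularGroup σ ρ μ) (-Complex.I) (leftAction σ ρ (star (a : A))) := by
  induction a using homogeneous_induction hgen with
  | hom n a ha =>
    rw [analyticAut_I_leftAction ρ hμ ha,
      analyticAut_neg_I_leftAction ρ hμ (σ.star_mem_spectralSubspace ha), star_smul,
      Complex.star_def, Complex.conj_ofReal, map_star, Int.cast_neg]
  | add a b ha hb =>
    have han := fun (z : ℂ) (a : 𝒜) => isAnalyticOperator_leftAction ρ (μ := μ) hgen z.im a
    rw [AddMemClass.coe_add, map_add, analyticAut_add (han _ a) (han _ b), star_add, ha, hb,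
      star_add, map_add]
    exact (analyticAut_add (han _ (star a)) (han _ (star b))).symm

end ModularGroup

/-! ### The modular lift -/

section ModularOperator

variable {A : Type*} [CStarAlgebra A] {σ : CircleAction A}
variable {H₀ : Type*} [NormedAddCommGroup H₀] [InnerProductSpace ℂ H₀] [CompleteSpace H₀]
variable {ρ : σ.fixedAlgebra →⋆ₐ[ℂ] (H₀ →L[ℂ] H₀)} {μ : ℝ}

theorem mem_modularOperatorGraph {n : ℤ} {g : LiftedSpace σ ρ} (hg : g ∈ gradedPart σ ρ n) :
    (g, ((μ ^ ((n : ℝ) / 2) : ℝ) : ℂ) • g) ∈ modularOperatorGraph σ ρ μ :=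
  Submodule.le_topologicalClosure _ (Submodule.subset_span ⟨n, g, hg, rfl⟩)

/-- The operator `Γ` multiplies the component of degree `n` by `μ ^ (n / 2)`. -/
theorem inner_of_mem_modularOperatorGraph {y z : LiftedSpace σ ρ}
    (hyz : (y, z) ∈ modularOperatorGraph σ ρ μ) {n : ℤ} {g : LiftedSpace σ ρ}
    (hg : g ∈ gradedPart σ ρ n) :
    ⟪g, z⟫_ℂ = ((μ ^ ((n : ℝ) / 2) : ℝ) : ℂ) * ⟪g, y⟫_ℂ := by
  let S : LiftedSpace σ ρ × LiftedSpace σ ρ →L[ℂ] ℂ := innerSL ℂ g ∘L ContinuousLinearMap.snd ℂ _ _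
  let T : LiftedSpace σ ρ × LiftedSpace σ ρ →L[ℂ] ℂ :=
    ((μ ^ ((n : ℝ) / 2) : ℝ) : ℂ) • (innerSL ℂ g ∘L ContinuousLinearMap.fst ℂ _ _)
  have h1 : modularOperatorGraph σ ρ μ ≤ LinearMap.eqLocus S.toLinearMap T.toLinearMap := by
    refine Submodule.topologicalClosure_minimal _ (Submodule.span_le.mpr ?_)
      (isClosed_eq S.continuous T.continuous)
    rintro _ ⟨m, η, hη, rfl⟩
    change ⟪g, ((μ ^ ((m : ℝ) / 2) : ℝ) : ℂ) • η⟫_ℂ = ((μ ^ ((n : ℝ) / 2) : ℝ) : ℂ) * ⟪g, η⟫_ℂ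
    rw [inner_smul_right]
    by_cases hnm : n = m
    · rw [hnm]
    · rw [inner_eq_zero_of_ne hnm hg hη, mul_zero, mul_zero]
  exact h1 hyz

end ModularOperator

section Standing

variable {A : Type*} [CStarAlgebra A] {σ : CircleAction A} {𝒜 : StarSubalgebra ℂ A}
variable {H₀ : Type*} [NormedAddCommGroup H₀] [InnerProductSpace ℂ H₀] [CompleteSpace H₀]
variable {H : Type*} [NormedAddCommGroup H] [InnerProductSpace ℂ H] [CompleteSpace H]

/-- The vector `(1 ⊗_∇ D₀)(x ⊗ ξ) = ∇(x) ξ + x ⊗ D₀ ξ` for `x` in `𝒜_n` and `ξ` in the domain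
of `D₀`. -/
noncomputable def horizontalVector (ρ : σ.fixedAlgebra →⋆ₐ[ℂ] (H₀ →L[ℂ] H₀)) (D₀ : H₀ →ₗ.[ℂ] H₀)
    (δ₀ : coreFixed σ 𝒜 → (H₀ →L[ℂ] H₀)) {n : ℤ} {k : ℕ} (ζ : Fin k → coreGraded σ 𝒜 n)
    (x : coreGraded σ 𝒜 n) (ξ : D₀.domain) : LiftedSpace σ ρ :=
  grassmannConnection ρ δ₀ ζ x ξ + simpleTensor σ ρ (x : A) (D₀ ξ)

/-- The graph of the restriction of the modular lift to the span of the `x ⊗ ξ` with `x` in `𝒜_n`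
and `ξ` in the domain of `D₀`, where it is `x ⊗ ξ ↦ μ ^ n (∇(x) ξ + x ⊗ D₀ ξ)`. -/
noncomputable def coreGraph (ρ : σ.fixedAlgebra →⋆ₐ[ℂ] (H₀ →L[ℂ] H₀)) (D₀ : H₀ →ₗ.[ℂ] H₀)
    (δ₀ : coreFixed σ 𝒜 → (H₀ →L[ℂ] H₀)) (μ : ℝ) {m : ℤ → ℕ}
    (ζ : ∀ n, Fin (m n) → coreGraded σ 𝒜 n) : Submodule ℂ (LiftedSpace σ ρ × LiftedSpace σ ρ) :=
  Submodule.span ℂ {p | ∃ (n : ℤ) (x : coreGraded σ 𝒜 n) (ξ : D₀.domain),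
    p = (simpleTensor σ ρ (x : A) ξ,
      ((μ ^ n : ℝ) : ℂ) • horizontalVector ρ D₀ δ₀ (ζ n) x ξ)}

variable {ρ : σ.fixedAlgebra →⋆ₐ[ℂ] (H₀ →L[ℂ] H₀)} {D₀ : H₀ →ₗ.[ℂ] H₀}
  {δ₀ : coreFixed σ 𝒜 → (H₀ →L[ℂ] H₀)}
variable {ι : H₀ →ₗᵢ[ℂ] H} {φ : A →⋆ₐ[ℂ] (H →L[ℂ] H)} {δ : 𝒜 →ₗ[ℂ] (H →L[ℂ] H)} {μ : ℝ}

theorem horizontalVector_mem {n : ℤ} {k : ℕ} (ζ : Fin k → coreGraded σ 𝒜 n)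
    (x : coreGraded σ 𝒜 n) (ξ : D₀.domain) :
    horizontalVector ρ D₀ δ₀ ζ x ξ ∈ gradedPart σ ρ n := by
  refine add_mem ?_ (simpleTensor_mem_gradedPart σ ρ x.2.2 _)
  rw [grassmannConnection, sum_apply]
  exact sum_mem fun j _ => simpleTensor_mem_gradedPart σ ρ (ζ j).2.2 _

theorem condExpₗ_star_mul_coreGraded {n : ℤ} (x y : coreGraded σ 𝒜 n) :
    σ.condExpₗ (star (x : A) * y) = (coreGraded.pairing x y : σ.fixedAlgebra) :=
  σ.condExpₗ_of_mem (σ.star_mul_mem_fixedAlgebra x.2.2 y.2.2)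

theorem inner_isSelfAdjoint {D : H →ₗ.[ℂ] H} (hD : IsSelfAdjoint D) (x y : D.domain) :
    ⟪D x, (y : H)⟫_ℂ = ⟪(x : H), D y⟫_ℂ := by
  have h := LinearPMap.adjoint_isFormalAdjoint hD.dense_domain
  rw [LinearPMap.isSelfAdjoint_def.mp hD] at h
  exact h x y

variable {m : ℤ → ℕ} {ζ : ∀ n, Fin (m n) → coreGraded σ 𝒜 n}

theorem mem_adjoint_coreGraph {y z : LiftedSpace σ ρ} :
    (y, z) ∈ (coreGraph ρ D₀ δ₀ μ ζ).adjoint ↔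
      ∀ (n : ℤ) (x : coreGraded σ 𝒜 n) (ξ : D₀.domain),
        ⟪((μ ^ n : ℝ) : ℂ) • horizontalVector ρ D₀ δ₀ (ζ n) x ξ, y⟫_ℂ =
          ⟪simpleTensor σ ρ (x : A) ξ, z⟫_ℂ := by
  rw [Submodule.mem_adjoint_iff]
  constructor
  · intro hyz n x ξ
    exact sub_eq_zero.mp (hyz _ _ (Submodule.subset_span ⟨n, x, ξ, rfl⟩))
  · intro hyz a b hab
    have : ∀ p ∈ coreGraph ρ D₀ δ₀ μ ζ, ⟪p.2, y⟫_ℂ - ⟪p.1, z⟫_ℂ = 0 := by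
      intro p hp
      induction hp using Submodule.span_induction with
      | zero => simp
      | add p q _ _ hp hq =>
        rw [Prod.fst_add, Prod.snd_add, inner_add_left, inner_add_left, add_sub_add_comm, hp, hq,
          add_zero]
      | smul c p _ hp =>
        rw [Prod.smul_fst, Prod.smul_snd, inner_smul_left, inner_smul_left, ← mul_sub, hp, mul_zero]
      | mem p hp =>
        obtain ⟨n, x, ξ, rfl⟩ := hp
        exact sub_eq_zero.mpr (hyz n x ξ)
    exact this (a, b) hab

theorem isClosed_adjoint_coreGraph :
    IsClosed ((coreGraph ρ D₀ δ₀ μ ζ).adjoint : Set (LiftedSpace σ ρ × LiftedSpace σ ρ)) := by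
  have : ((coreGraph ρ D₀ δ₀ μ ζ).adjoint : Set (LiftedSpace σ ρ × LiftedSpace σ ρ)) =
      ⋂ (n : ℤ) (x : coreGraded σ 𝒜 n) (ξ : D₀.domain),
        {p | ⟪((μ ^ n : ℝ) : ℂ) • horizontalVector ρ D₀ δ₀ (ζ n) x ξ, p.1⟫_ℂ =
          ⟪simpleTensor σ ρ (x : A) ξ, p.2⟫_ℂ} := by
    ext ⟨y, z⟩
    simp only [Set.mem_iInter]
    exact mem_adjoint_coreGraph
  rw [this]
  refine isClosed_iInter fun n => isClosed_iInter fun x => isClosed_iInter fun ξ => ?_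
  exact isClosed_eq (by fun_prop) (by fun_prop)

namespace StandingAssumptions

variable (h : StandingAssumptions ρ D₀ δ₀ ι φ δ μ)
include h

theorem pow_ne_zero (n : ℤ) : ((μ ^ n : ℝ) : ℂ) ≠ 0 := by
  exact_mod_cast (zpow_pos h.exp.pos n).ne'

/-- On `G_n` the horizontal lift is the compression `∑ θ_{ζ_j} D₀ θ_{ζ_j}^*`. -/
theorem horizontalVector_eq_sum {n : ℤ} {k : ℕ} {ζ : Fin k → coreGraded σ 𝒜 n}
    (hζ : IsVanishingFrame φ δ ζ) (x : coreGraded σ 𝒜 n) (ξ : D₀.domain) :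
    ∃ hdom : ∀ j, ρ (coreGraded.pairing (ζ j) x) ξ ∈ D₀.domain,
      horizontalVector ρ D₀ δ₀ ζ x ξ = ∑ j, simpleTensor σ ρ (ζ j : A) (D₀ ⟨_, hdom j⟩) := by
  choose hdom hcomm using fun j => h.triple.lipschitz (coreGraded.pairing (ζ j) x) ξ
  refine ⟨hdom, ?_⟩
  have hx := sum_creation_adjoint (fun j => (ζ j).2.2) (h.exp.sum_frame_mul_star hζ)
    (simpleTensor_mem_gradedPart σ ρ x.2.2 (D₀ ξ))
  rw [horizontalVector, ← hx, grassmannConnection, sum_apply, ← Finset.sum_add_distrib]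
  refine Finset.sum_congr rfl fun j _ => ?_
  rw [ContinuousLinearMap.comp_apply, hcomm, adjoint_creation_simpleTensor,
    condExpₗ_star_mul_coreGraded, ← map_add, sub_add_cancel, creation_apply]

/-- The horizontal lift is symmetric. -/
theorem inner_horizontalVector {n : ℤ} {k : ℕ} {ζ : Fin k → coreGraded σ 𝒜 n}
    (hζ : IsVanishingFrame φ δ ζ) (x y : coreGraded σ 𝒜 n) (ξ η : D₀.domain) :
    ⟪horizontalVector ρ D₀ δ₀ ζ x ξ, simpleTensor σ ρ (y : A) η⟫_ℂ =
      ⟪simpleTensor σ ρ (x : A) ξ, horizontalVector ρ D₀ δ₀ ζ y η⟫_ℂ := by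
  obtain ⟨hx, hx'⟩ := h.horizontalVector_eq_sum hζ x ξ
  obtain ⟨hy, hy'⟩ := h.horizontalVector_eq_sum hζ y η
  rw [hx', hy', sum_inner, inner_sum]
  refine Finset.sum_congr rfl fun j _ => ?_
  rw [inner_simpleTensor, condExpₗ_star_mul_coreGraded, ← inner_conj_symm (simpleTensor σ ρ _ _),
    inner_simpleTensor, condExpₗ_star_mul_coreGraded, inner_conj_symm]
  exact inner_isSelfAdjoint h.triple.selfAdjoint ⟨_, hx j⟩ ⟨_, hy j⟩

/-- Since the frame is annihilated by `δ`, its Grassmann connection is `μ ^ (-n) δ` in the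
picture on `H`; in particular it does not depend on the frame. -/
theorem transport_horizontalVector {U : ℤ → LiftedSpace σ ρ →L[ℂ] H} (hU : IsTransport ρ ι φ U)
    {n : ℤ} {k : ℕ} {ζ : Fin k → coreGraded σ 𝒜 n} (hζ : IsVanishingFrame φ δ ζ)
    (x : coreGraded σ 𝒜 n) (ξ : D₀.domain) :
    ((μ ^ n : ℝ) : ℂ) • U n (horizontalVector ρ D₀ δ₀ ζ x ξ) =
      δ (coreGraded.toCore x) (ι ξ) + ((μ ^ n : ℝ) : ℂ) • φ x (ι (D₀ ξ)) := by
  have hφ : ∑ j, φ (ζ j) * φ (star (ζ j : A)) = 1 := by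
    simp only [← map_mul]
    rw [← map_sum, h.exp.sum_frame_mul_star hζ, map_one]
  have hterm : ∀ j, U n (creation σ ρ (ζ j : A) (δ₀ (coreGraded.pairing (ζ j) x) ξ)) =
      ((φ (ζ j) * δ (star (coreGraded.toCore (ζ j)))) * φ x) (ι ξ) +
        ((μ ^ (-n) : ℝ) : ℂ) •
          ((φ (ζ j) * φ (star (ζ j : A))) * δ (coreGraded.toCore x)) (ι ξ) := fun j => by
    have hl := h.exp.twisted_leibniz (-n) (star (coreGraded.toCore (ζ j))) (coreGraded.toCore x)
      (σ.star_mem_spectralSubspace (ζ j).2.2)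
    have hr := h.exp.derivation_restrict (star (coreGraded.toCore (ζ j)) * coreGraded.toCore x)
      (σ.star_mul_mem_fixedAlgebra (ζ j).2.2 x.2.2) ξ
    rw [creation_apply, hU.apply_simpleTensor n _ (ζ j).2.2]
    refine (congrArg (φ (ζ j)) (hr.symm.trans (congrArg (fun T : H →L[ℂ] H => T (ι ξ)) hl))).trans ?_
    simp only [add_apply, map_add, smul_apply, map_smul, mul_apply_eq_comp]
    rfl
  rw [horizontalVector, map_add, hU.apply_simpleTensor n _ x.2.2, smul_add, grassmannConnection,
    sum_apply, map_sum]
  simp only [ContinuousLinearMap.comp_apply, hterm, Finset.sum_add_distrib, ← Finset.smul_sum,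
    ← sum_apply, ← Finset.sum_mul, hζ.vanish, hφ, zero_mul, one_mul]
  congr 1
  rw [zero_apply, zero_add, smul_smul, ← Complex.ofReal_mul, ← zpow_add₀ h.exp.pos.ne',
    add_neg_cancel, zpow_zero, Complex.ofReal_one, one_smul]

theorem eq_of_mem_adjoint_coreGraph {y z z' : LiftedSpace σ ρ}
    (hz : (y, z) ∈ (coreGraph ρ D₀ δ₀ μ ζ).adjoint)
    (hz' : (y, z') ∈ (coreGraph ρ D₀ δ₀ μ ζ).adjoint) : z = z' :=
  h.ext_inner_core fun n x hx ξ hξ =>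
    (mem_adjoint_coreGraph.mp hz n ⟨x, hx⟩ ⟨ξ, hξ⟩).symm.trans
      (mem_adjoint_coreGraph.mp hz' n ⟨x, hx⟩ ⟨ξ, hξ⟩)

theorem coreGraph_le_graphComp : coreGraph ρ D₀ δ₀ μ ζ ≤
    graphComp (modularOperatorGraph σ ρ μ) (graphComp (modularOperatorGraph σ ρ μ)
      (horizontalLiftGraph ρ D₀ δ₀ ζ)) := by
  refine Submodule.span_le.mpr ?_
  rintro _ ⟨n, x, ξ, rfl⟩
  have hv := horizontalVector_mem (ρ := ρ) (δ₀ := δ₀) (ζ n) x ξ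
  refine ⟨((μ ^ ((n : ℝ) / 2) : ℝ) : ℂ) • horizontalVector ρ D₀ δ₀ (ζ n) x ξ,
    ⟨horizontalVector ρ D₀ δ₀ (ζ n) x ξ, Submodule.subset_span ⟨n, x, ξ, rfl⟩,
      mem_modularOperatorGraph hv⟩, ?_⟩
  have h2 := mem_modularOperatorGraph (μ := μ)
    ((gradedPart σ ρ n).smul_mem ((μ ^ ((n : ℝ) / 2) : ℝ) : ℂ) hv)
  rwa [smul_smul, ← Complex.ofReal_mul, ← Real.rpow_add h.exp.pos, add_halves,
    Real.rpow_intCast] at h2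

variable (hζ : ∀ n, IsVanishingFrame φ δ (ζ n))
include hζ

theorem graphComp_le_adjoint :
    graphComp (modularOperatorGraph σ ρ μ) (graphComp (modularOperatorGraph σ ρ μ)
      (horizontalLiftGraph ρ D₀ δ₀ ζ)) ≤ (coreGraph ρ D₀ δ₀ μ ζ).adjoint := by
  rintro ⟨y, z⟩ ⟨v, ⟨w, hyw, hwv⟩, hvz⟩
  refine mem_adjoint_coreGraph.mpr fun n x ξ => ?_
  have hx := simpleTensor_mem_gradedPart σ ρ x.2.2 (ξ : H₀)
  change (y, w) ∈ horizontalLiftGraph ρ D₀ δ₀ ζ at hyw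
  change (w, v) ∈ modularOperatorGraph σ ρ μ at hwv
  change (v, z) ∈ modularOperatorGraph σ ρ μ at hvz
  rw [inner_of_mem_modularOperatorGraph hvz hx, inner_of_mem_modularOperatorGraph hwv hx,
    ← mul_assoc, ← Complex.ofReal_mul, ← Real.rpow_add h.exp.pos, add_halves, Real.rpow_intCast,
    inner_smul_left, Complex.conj_ofReal]
  congr 1
  have : ∀ p ∈ horizontalLiftGraph ρ D₀ δ₀ ζ, ⟪horizontalVector ρ D₀ δ₀ (ζ n) x ξ, p.1⟫_ℂ =
      ⟪simpleTensor σ ρ (x : A) ξ, p.2⟫_ℂ := by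
    intro p hp
    induction hp using Submodule.span_induction with
    | zero => simp
    | add p q _ _ hp hq => rw [Prod.fst_add, Prod.snd_add, inner_add_right, inner_add_right, hp, hq]
    | smul c p _ hp => rw [Prod.smul_fst, Prod.smul_snd, inner_smul_right, inner_smul_right, hp]
    | mem p hp =>
      obtain ⟨k, x', ξ', rfl⟩ := hp
      by_cases hnk : n = k
      · subst hnk
        exact h.inner_horizontalVector (hζ n) x x' ξ ξ'
      · exact (inner_eq_zero_of_ne hnk (horizontalVector_mem (ζ n) x ξ)
          (simpleTensor_mem_gradedPart σ ρ x'.2.2 (ξ' : H₀))).trans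
          (inner_eq_zero_of_ne hnk hx (horizontalVector_mem (ζ k) x' ξ')).symm
  exact this (y, w) hyw

/-- The compression of the adjoint relation to `G_n` is an operator whose domain consists of the
finite sums of the `x ⊗ ξ`: the coefficients `θ_{ζ_j}^* y` in the frame expansion of `y` lie in the
domain of `D₀^* = D₀`. -/
theorem mem_coreGraph_of_mem_adjoint {n : ℤ} {y z : LiftedSpace σ ρ}
    (hyz : (y, z) ∈ (coreGraph ρ D₀ δ₀ μ ζ).adjoint) (hy : y ∈ gradedPart σ ρ n) :
    (y, z) ∈ coreGraph ρ D₀ δ₀ μ ζ := by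
  have hdom : ∀ j, (creation σ ρ (ζ n j : A)).adjoint y ∈ D₀.domain := by
    intro j
    rw [← LinearPMap.isSelfAdjoint_def.mp h.triple.selfAdjoint]
    refine LinearPMap.mem_adjoint_domain_of_exists _
      ⟨((μ ^ n : ℝ) : ℂ)⁻¹ • (creation σ ρ (ζ n j : A)).adjoint z -
        (grassmannConnection ρ δ₀ (ζ n) (ζ n j)).adjoint y, fun ξ => ?_⟩
    have h1 := mem_adjoint_coreGraph.mp hyz n (ζ n j) ξ
    rw [← inner_conj_symm _ y, ← inner_conj_symm _ z] at h1
    have h1 := star_injective h1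
    rw [inner_smul_right, horizontalVector, inner_add_right] at h1
    rw [inner_sub_left, inner_smul_left, ContinuousLinearMap.adjoint_inner_left,
      ContinuousLinearMap.adjoint_inner_left, ContinuousLinearMap.adjoint_inner_left,
      creation_apply, creation_apply, ← h1, map_inv₀, Complex.conj_ofReal,
      inv_mul_cancel_left₀ (h.pow_ne_zero n), add_sub_cancel_left]
  have hsum := sum_creation_adjoint (fun j => (ζ n j).2.2) (h.exp.sum_frame_mul_star (hζ n)) hy
  have hmem : (y, ∑ j, ((μ ^ n : ℝ) : ℂ) •
      horizontalVector ρ D₀ δ₀ (ζ n) (ζ n j) ⟨_, hdom j⟩) ∈ coreGraph ρ D₀ δ₀ μ ζ := by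
    have : (y, ∑ j, ((μ ^ n : ℝ) : ℂ) • horizontalVector ρ D₀ δ₀ (ζ n) (ζ n j) ⟨_, hdom j⟩) =
        ∑ j, (simpleTensor σ ρ (ζ n j : A) ((creation σ ρ (ζ n j : A)).adjoint y),
          ((μ ^ n : ℝ) : ℂ) • horizontalVector ρ D₀ δ₀ (ζ n) (ζ n j) ⟨_, hdom j⟩) := by
      refine Prod.ext ?_ ?_
      · rw [Prod.fst_sum]; exact hsum.symm
      · rw [Prod.snd_sum]
    rw [this]
    exact sum_mem fun j _ => Submodule.subset_span ⟨n, ζ n j, ⟨_, hdom j⟩, rfl⟩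
  have h2 := h.graphComp_le_adjoint hζ (h.coreGraph_le_graphComp hmem)
  rwa [h.eq_of_mem_adjoint_coreGraph hyz h2]

theorem adjoint_le_topologicalClosure :
    (coreGraph ρ D₀ δ₀ μ ζ).adjoint ≤ (coreGraph ρ D₀ δ₀ μ ζ).topologicalClosure := by
  rintro ⟨y, z⟩ hyz
  obtain ⟨U, hU⟩ := h.exists_isTransport
  have hcomp : ∀ n, ((U n).adjoint (U n y), (U n).adjoint (U n z)) ∈ coreGraph ρ D₀ δ₀ μ ζ := by
    intro n
    refine h.mem_coreGraph_of_mem_adjoint hζ (mem_adjoint_coreGraph.mpr fun k x ξ => ?_)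
      (hU.adjoint_mem h n _)
    have hv := (gradedPart σ ρ k).smul_mem ((μ ^ k : ℝ) : ℂ)
      (horizontalVector_mem (ρ := ρ) (δ₀ := δ₀) (ζ k) x ξ)
    have hx := simpleTensor_mem_gradedPart σ ρ x.2.2 (ξ : H₀)
    by_cases hnk : k = n
    · subst hnk
      rw [ContinuousLinearMap.adjoint_inner_right, ← ContinuousLinearMap.adjoint_inner_left,
        hU.adjoint_apply_self h hv, ContinuousLinearMap.adjoint_inner_right,
        ← ContinuousLinearMap.adjoint_inner_left, hU.adjoint_apply_self h hx]
      exact mem_adjoint_coreGraph.mp hyz k x ξ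
    · rw [inner_eq_zero_of_ne hnk hv (hU.adjoint_mem h n _),
        inner_eq_zero_of_ne hnk hx (hU.adjoint_mem h n _)]
  have hsum := (hU.hasSum_adjoint_apply h y).prodMk (hU.hasSum_adjoint_apply h z)
  exact (Submodule.isClosed_topologicalClosure _).mem_of_tendsto hsum
    (Filter.Eventually.of_forall fun F => sum_mem fun n _ =>
      Submodule.le_topologicalClosure _ (hcomp n))

/-- The closure of the graph of `Γ² (1 ⊗_∇ D₀)` is the adjoint of its restriction to the core. -/
theorem modularLiftGraph_eq_adjoint :
    modularLiftGraph ρ D₀ δ₀ μ ζ = (coreGraph ρ D₀ δ₀ μ ζ).adjoint :=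
  le_antisymm
    (Submodule.topologicalClosure_minimal _ (h.graphComp_le_adjoint hζ) isClosed_adjoint_coreGraph)
    ((h.adjoint_le_topologicalClosure hζ).trans
      (Submodule.topologicalClosure_mono h.coreGraph_le_graphComp))

theorem modularLiftGraph_eq_closure :
    modularLiftGraph ρ D₀ δ₀ μ ζ = (coreGraph ρ D₀ δ₀ μ ζ).topologicalClosure :=
  le_antisymm
    ((h.modularLiftGraph_eq_adjoint hζ).trans_le (h.adjoint_le_topologicalClosure hζ))
    (Submodule.topologicalClosure_mono h.coreGraph_le_graphComp)

theorem graph_modularLift :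
    (modularLift ρ D₀ δ₀ μ ζ).graph = modularLiftGraph ρ D₀ δ₀ μ ζ := by
  refine Submodule.toLinearPMap_graph_eq _ ?_
  rintro ⟨y, z⟩ hyz (rfl : y = 0)
  rw [h.modularLiftGraph_eq_adjoint hζ] at hyz
  exact h.eq_of_mem_adjoint_coreGraph hyz (Submodule.zero_mem _)

theorem isClosed_graph_modularLift :
    IsClosed ((modularLift ρ D₀ δ₀ μ ζ).graph : Set (LiftedSpace σ ρ × LiftedSpace σ ρ)) := by
  rw [h.graph_modularLift hζ]
  exact Submodule.isClosed_topologicalClosure _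

theorem core_mem_graph {n : ℤ} (x : coreGraded σ 𝒜 n) (ξ : D₀.domain) :
    (simpleTensor σ ρ (x : A) ξ, ((μ ^ n : ℝ) : ℂ) • horizontalVector ρ D₀ δ₀ (ζ n) x ξ) ∈
      (modularLift ρ D₀ δ₀ μ ζ).graph := by
  rw [h.graph_modularLift hζ, h.modularLiftGraph_eq_closure hζ]
  exact Submodule.le_topologicalClosure _ (Submodule.subset_span ⟨n, x, ξ, rfl⟩)

/-- A closed relation which contains the graph of the modular lift on the core contains the whole
graph. -/
theorem graph_le_of_core {K : Submodule ℂ (LiftedSpace σ ρ × LiftedSpace σ ρ)}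
    (hK : IsClosed (K : Set (LiftedSpace σ ρ × LiftedSpace σ ρ)))
    (hc : ∀ (n : ℤ) (x : coreGraded σ 𝒜 n) (ξ : D₀.domain),
      (simpleTensor σ ρ (x : A) ξ, ((μ ^ n : ℝ) : ℂ) • horizontalVector ρ D₀ δ₀ (ζ n) x ξ) ∈ K) :
    (modularLift ρ D₀ δ₀ μ ζ).graph ≤ K := by
  rw [h.graph_modularLift hζ, h.modularLiftGraph_eq_closure hζ]
  refine Submodule.topologicalClosure_minimal _ (Submodule.span_le.mpr ?_) hK
  rintro _ ⟨n, x, ξ, rfl⟩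
  exact hc n x ξ

theorem dense_domain_modularLift :
    Dense ((modularLift ρ D₀ δ₀ μ ζ).domain : Set (LiftedSpace σ ρ)) := by
  rw [Submodule.dense_iff_topologicalClosure_eq_top]
  refine h.mem_closed_of_core (Submodule.isClosed_topologicalClosure _) fun n x hx ξ hξ => ?_
  exact Submodule.le_topologicalClosure _
    (LinearPMap.mem_domain_of_mem_graph (h.core_mem_graph hζ ⟨x, hx⟩ ⟨ξ, hξ⟩))

theorem isSelfAdjoint_modularLift : IsSelfAdjoint (modularLift ρ D₀ δ₀ μ ζ) := by
  rw [LinearPMap.isSelfAdjoint_def]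
  apply LinearPMap.eq_of_eq_graph
  rw [LinearPMap.adjoint_graph_eq_graph_adjoint (h.dense_domain_modularLift hζ)]
  refine le_antisymm ?_ ?_
  · rintro ⟨y, z⟩ hyz
    rw [h.graph_modularLift hζ, h.modularLiftGraph_eq_adjoint hζ]
    refine mem_adjoint_coreGraph.mpr fun n x ξ => ?_
    exact sub_eq_zero.mp ((Submodule.mem_adjoint_iff _ _).mp hyz _ _ (h.core_mem_graph hζ x ξ))
  · rintro ⟨y, z⟩ hyz
    rw [Submodule.mem_adjoint_iff]
    intro a b hab
    let S : LiftedSpace σ ρ × LiftedSpace σ ρ →L[ℂ] ℂ :=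
      innerSL ℂ y ∘L ContinuousLinearMap.snd ℂ _ _
    let T : LiftedSpace σ ρ × LiftedSpace σ ρ →L[ℂ] ℂ :=
      innerSL ℂ z ∘L ContinuousLinearMap.fst ℂ _ _
    have h1 : (modularLift ρ D₀ δ₀ μ ζ).graph ≤
        LinearMap.eqLocus S.toLinearMap T.toLinearMap := by
      refine h.graph_le_of_core hζ (isClosed_eq S.continuous T.continuous) fun n x ξ => ?_
      change ⟪y, ((μ ^ n : ℝ) : ℂ) • horizontalVector ρ D₀ δ₀ (ζ n) x ξ⟫_ℂ =
        ⟪z, simpleTensor σ ρ (x : A) ξ⟫_ℂ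
      rw [h.graph_modularLift hζ, h.modularLiftGraph_eq_adjoint hζ] at hyz
      rw [← inner_conj_symm, mem_adjoint_coreGraph.mp hyz n x ξ, inner_conj_symm]
    have h2 : ⟪y, b⟫_ℂ = ⟪z, a⟫_ℂ := h1 hab
    rw [← inner_conj_symm, h2, inner_conj_symm, sub_self]

end StandingAssumptions

end Standing

/-! ### Twisted commutators with a selfadjoint operator -/

section Commutator

variable {H : Type*} [NormedAddCommGroup H] [InnerProductSpace ℂ H]
variable {D : H →ₗ.[ℂ] H} {T T' S T₁ T₁' S₁ : H →L[ℂ] H}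

theorem extendsCommutator_iff : ExtendsCommutator D T T' S ↔
    ∀ y z, (y, z) ∈ D.graph → (T y, S y + T' z) ∈ D.graph := by
  constructor
  · intro h y z hyz
    obtain ⟨ξ, hξ⟩ := (LinearPMap.mem_graph_iff _).mp hyz
    obtain ⟨rfl, rfl⟩ : (ξ : H) = y ∧ D ξ = z := hξ
    obtain ⟨hdom, hS⟩ := h ξ
    rw [hS, sub_add_cancel]
    exact D.mem_graph ⟨T ξ, hdom⟩
  · intro h ξ
    obtain ⟨η, hη⟩ := (LinearPMap.mem_graph_iff _).mp (h _ _ (D.mem_graph ξ))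
    obtain ⟨h1, h2⟩ : (η : H) = T ξ ∧ D η = S ξ + T' (D ξ) := hη
    have hdom : T ξ ∈ D.domain := h1 ▸ η.2
    obtain rfl : η = ⟨T ξ, hdom⟩ := Subtype.ext h1
    exact ⟨hdom, by rw [h2, add_sub_cancel_right]⟩

namespace ExtendsCommutator

theorem unique (hD : Dense (D.domain : Set H)) (h : ExtendsCommutator D T T' S)
    (h' : ExtendsCommutator D T T' S₁) : S = S₁ := by
  refine ContinuousLinearMap.ext fun x => congrFun
    (Continuous.ext_on hD S.continuous S₁.continuous fun ξ hξ => ?_) x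
  obtain ⟨_, h1⟩ := h ⟨ξ, hξ⟩
  obtain ⟨_, h2⟩ := h' ⟨ξ, hξ⟩
  exact h1.trans h2.symm

theorem add (h : ExtendsCommutator D T T' S) (h₁ : ExtendsCommutator D T₁ T₁' S₁) :
    ExtendsCommutator D (T + T₁) (T' + T₁') (S + S₁) := by
  rw [extendsCommutator_iff] at *
  intro y z hyz
  convert D.graph.add_mem (h y z hyz) (h₁ y z hyz) using 1
  refine Prod.ext rfl ?_
  simp only [Prod.snd_add, add_apply]
  abel

theorem smul (c : ℂ) (h : ExtendsCommutator D T T' S) :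
    ExtendsCommutator D (c • T) (c • T') (c • S) := by
  rw [extendsCommutator_iff] at *
  intro y z hyz
  convert D.graph.smul_mem c (h y z hyz) using 1
  refine Prod.ext rfl ?_
  simp only [Prod.smul_snd, smul_apply, smul_add]

theorem mul (h : ExtendsCommutator D T T' S) (h₁ : ExtendsCommutator D T₁ T₁' S₁) :
    ExtendsCommutator D (T * T₁) (T' * T₁') (S * T₁ + T' * S₁) := by
  rw [extendsCommutator_iff] at *
  intro y z hyz
  convert h _ _ (h₁ y z hyz) using 1
  refine Prod.ext rfl ?_
  simp only [add_apply, mul_apply_eq_comp, map_add, add_assoc]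

theorem star [CompleteSpace H] (hD : IsSelfAdjoint D) (h : ExtendsCommutator D T T' S) :
    ExtendsCommutator D (star T') (star T) (-star S) := by
  rw [extendsCommutator_iff] at *
  have hg : D.graph = D.graph.adjoint := by
    rw [← LinearPMap.adjoint_graph_eq_graph_adjoint hD.dense_domain,
      LinearPMap.isSelfAdjoint_def.mp hD]
  intro y z hyz
  rw [hg, Submodule.mem_adjoint_iff]
  intro a b hab
  have h1 := (Submodule.mem_adjoint_iff _ _).mp (hg ▸ hyz) _ _ (h a b hab)
  simp only [inner_add_left] at h1
  simp only [neg_apply, ContinuousLinearMap.star_eq_adjoint, inner_add_right, inner_neg_right,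
    ContinuousLinearMap.adjoint_inner_right]
  linear_combination h1

end ExtendsCommutator

end Commutator

section Standing

variable {A : Type*} [CStarAlgebra A] {σ : CircleAction A} {𝒜 : StarSubalgebra ℂ A}
variable {H₀ : Type*} [NormedAddCommGroup H₀] [InnerProductSpace ℂ H₀] [CompleteSpace H₀]
variable {H : Type*} [NormedAddCommGroup H] [InnerProductSpace ℂ H] [CompleteSpace H]
variable {ρ : σ.fixedAlgebra →⋆ₐ[ℂ] (H₀ →L[ℂ] H₀)} {D₀ : H₀ →ₗ.[ℂ] H₀}
  {δ₀ : coreFixed σ 𝒜 → (H₀ →L[ℂ] H₀)}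
variable {ι : H₀ →ₗᵢ[ℂ] H} {φ : A →⋆ₐ[ℂ] (H →L[ℂ] H)} {δ : 𝒜 →ₗ[ℂ] (H →L[ℂ] H)} {μ : ℝ}

/-! ### The twisted derivation -/

namespace IsTransport

variable {U : ℤ → LiftedSpace σ ρ →L[ℂ] H} (hU : IsTransport ρ ι φ U)
include hU

/-- The isometry `U_n` intertwines the actions of `A` on `G` and on `H`. -/
theorem apply_leftAction {n k : ℤ} {a : A} (ha : a ∈ σ.spectralSubspace n) {g : LiftedSpace σ ρ}
    (hg : g ∈ gradedPart σ ρ k) : U (n + k) (leftAction σ ρ a g) = φ a (U k g) := by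
  refine eq_of_mem_gradedPart (S := U (n + k) ∘L leftAction σ ρ a) (T := φ a ∘L U k)
    (fun x hx ξ => ?_) hg
  rw [ContinuousLinearMap.comp_apply, ContinuousLinearMap.comp_apply, leftAction_simpleTensor,
    hU.apply_simpleTensor _ _ (σ.mul_mem_spectralSubspace ha hx), hU.apply_simpleTensor _ _ hx,
    map_mul]
  rfl

variable (h : StandingAssumptions ρ D₀ δ₀ ι φ δ μ)
include h

theorem sum_norm_mul_norm_le (n : ℤ) (v w : LiftedSpace σ ρ) (F : Finset ℤ) :
    ∑ k ∈ F, ‖U k v‖ * ‖U (n + k) w‖ ≤ ‖v‖ * ‖w‖ := by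
  have h1 := hU.sum_norm_sq_le h F v
  have h2 : ∑ k ∈ F, ‖U (n + k) w‖ ^ 2 ≤ ‖w‖ ^ 2 := by
    have := hU.sum_norm_sq_le h (F.map (addLeftEmbedding n)) w
    rwa [Finset.sum_map] at this
  refine abs_le_of_sq_le_sq' ?_ (by positivity) |>.2
  calc (∑ k ∈ F, ‖U k v‖ * ‖U (n + k) w‖) ^ 2
      ≤ (∑ k ∈ F, ‖U k v‖ ^ 2) * ∑ k ∈ F, ‖U (n + k) w‖ ^ 2 :=
        Finset.sum_mul_sq_le_sq_mul_sq _ _ _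
    _ ≤ ‖v‖ ^ 2 * ‖w‖ ^ 2 :=
        mul_le_mul h1 h2 (Finset.sum_nonneg fun _ _ => by positivity) (by positivity)
    _ = _ := by ring

/-- A bounded operator `B` on `H` induces the bounded operator of degree `n` on `G` with the
blocks `U_{n+k}^* B U_k : G_k → G_{n+k}`. -/
theorem exists_blockOperator (n : ℤ) (B : H →L[ℂ] H) :
    ∃ S : LiftedSpace σ ρ →L[ℂ] LiftedSpace σ ρ, ∀ k, ∀ g ∈ gradedPart σ ρ k,
      S g = (U (n + k)).adjoint (B (U k g)) := by
  have hle : ∀ v w, ∀ F : Finset ℤ,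
      ∑ k ∈ F, ‖⟪B (U k v), U (n + k) w⟫_ℂ‖ ≤ ‖B‖ * ‖v‖ * ‖w‖ := fun v w F =>
    calc ∑ k ∈ F, ‖⟪B (U k v), U (n + k) w⟫_ℂ‖
        ≤ ∑ k ∈ F, ‖B‖ * (‖U k v‖ * ‖U (n + k) w‖) := Finset.sum_le_sum fun k _ => by
          refine (norm_inner_le_norm _ _).trans ?_
          rw [← mul_assoc]
          gcongr
          exact B.le_opNorm _
      _ ≤ ‖B‖ * ‖v‖ * ‖w‖ := by
          rw [← Finset.mul_sum, mul_assoc]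
          gcongr
          exact hU.sum_norm_mul_norm_le h n v w F
  have hsn : ∀ v w, Summable fun k => ‖⟪B (U k v), U (n + k) w⟫_ℂ‖ := fun v w =>
    summable_of_sum_le (fun _ => norm_nonneg _) (hle v w)
  have hs : ∀ v w, Summable fun k => ⟪B (U k v), U (n + k) w⟫_ℂ := fun v w => (hsn v w).of_norm
  let b : LiftedSpace σ ρ →ₗ⋆[ℂ] LiftedSpace σ ρ →ₗ[ℂ] ℂ :=
    LinearMap.mk₂'ₛₗ (starRingEnd ℂ) (RingHom.id ℂ)
      (fun v w => ∑' k, ⟪B (U k v), U (n + k) w⟫_ℂ)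
      (fun v v' w => by
        simp only [map_add, inner_add_left]
        exact (hs v w).tsum_add (hs v' w))
      (fun c v w => by
        simp only [map_smul, inner_smul_left, smul_eq_mul]
        exact tsum_mul_left)
      (fun v w w' => by
        simp only [map_add, inner_add_right]
        exact (hs v w).tsum_add (hs v w'))
      (fun c v w => by
        simp only [map_smul, inner_smul_right, smul_eq_mul, RingHom.id_apply]
        exact tsum_mul_left)
  let b' := b.mkContinuous₂ ‖B‖ fun v w =>
    (norm_tsum_le_tsum_norm (hsn v w)).trans ((hsn v w).tsum_le_of_sum_le (hle v w))
  refine ⟨InnerProductSpace.continuousLinearMapOfBilin b', fun k g hg => ?_⟩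
  refine ext_inner_right ℂ fun w => ?_
  rw [InnerProductSpace.continuousLinearMapOfBilin_apply, ContinuousLinearMap.adjoint_inner_left]
  change ∑' k, ⟪B (U k g), U (n + k) w⟫_ℂ = _
  refine tsum_eq_single k fun k' hk' => ?_
  rw [hU.apply_of_ne k' k hk' g hg, map_zero, inner_zero_left]

variable {m : ℤ → ℕ} {ζ : ∀ n, Fin (m n) → coreGraded σ 𝒜 n}
variable (hζ : ∀ n, IsVanishingFrame φ δ (ζ n))
include hζ

/-- The twisted commutator of the modular lift with `a` in `𝒜_n`, on the core: the twisted Leibniz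
rule for `δ` leaves exactly `μ ^ (-n / 2) δ(a)` in the picture on `H`. -/
theorem apply_commutator {n k : ℤ} (a : coreGraded σ 𝒜 n) (x : coreGraded σ 𝒜 k)
    (ax : coreGraded σ 𝒜 (n + k)) (hax : (ax : A) = a * x) (ξ : D₀.domain) :
    U (n + k) (((μ ^ (-(n : ℝ) / 2) : ℝ) : ℂ) •
        (((μ ^ (n + k) : ℝ) : ℂ) • horizontalVector ρ D₀ δ₀ (ζ (n + k)) ax ξ) -
      ((μ ^ ((n : ℝ) / 2) : ℝ) : ℂ) • leftAction σ ρ a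
        (((μ ^ k : ℝ) : ℂ) • horizontalVector ρ D₀ δ₀ (ζ k) x ξ)) =
      ((μ ^ (-(n : ℝ) / 2) : ℝ) : ℂ) •
        δ (coreGraded.toCore a) (U k (simpleTensor σ ρ (x : A) ξ)) := by
  have hv := (gradedPart σ ρ k).smul_mem ((μ ^ k : ℝ) : ℂ)
    (horizontalVector_mem (ρ := ρ) (δ₀ := δ₀) (ζ k) x ξ)
  have hpow : ((μ ^ ((n : ℝ) / 2) : ℝ) : ℂ) = ((μ ^ (-(n : ℝ) / 2) : ℝ) : ℂ) * ((μ ^ n : ℝ) : ℂ) := by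
    rw [← Complex.ofReal_mul, ← Real.rpow_intCast, ← Real.rpow_add h.exp.pos]
    congr 2
    ring
  have hl := h.exp.twisted_leibniz n (coreGraded.toCore a) (coreGraded.toCore x) a.2.2
  have hax' : coreGraded.toCore ax = coreGraded.toCore a * coreGraded.toCore x := Subtype.ext hax
  rw [map_sub, map_smul, map_smul, map_smul, hU.apply_leftAction a.2.2 hv, map_smul,
    h.transport_horizontalVector hU (hζ (n + k)), h.transport_horizontalVector hU (hζ k),
    hU.apply_simpleTensor k _ x.2.2, hpow, mul_smul, ← smul_sub]
  congr 1
  rw [hax', hl, hax, map_mul, zpow_add₀ h.exp.pos.ne', Complex.ofReal_mul, mul_smul]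
  simp only [add_apply, smul_apply, mul_apply_eq_comp, map_add, map_smul, smul_add]
  change _ + ((μ ^ n : ℝ) : ℂ) • φ (a : A) (δ (coreGraded.toCore x) (ι ξ)) + _ - _ = _
  rw [add_assoc, add_sub_cancel_right]
  rfl

theorem exists_twistedDerivation_of_mem {n : ℤ} (a : coreGraded σ 𝒜 n) :
    ∃ S : LiftedSpace σ ρ →L[ℂ] LiftedSpace σ ρ,
      ExtendsCommutator (modularLift ρ D₀ δ₀ μ ζ)
        (analyticAut (modularGroup σ ρ μ) Complex.I (leftAction σ ρ a))
        (analyticAut (modularGroup σ ρ μ) (-Complex.I) (leftAction σ ρ a)) S ∧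
      ∀ k, ∀ g ∈ gradedPart σ ρ k, S g ∈ gradedPart σ ρ (n + k) ∧
        U (n + k) (S g) =
          ((μ ^ (-(n : ℝ) / 2) : ℝ) : ℂ) • δ (coreGraded.toCore a) (U k g) := by
  obtain ⟨S, hS⟩ := hU.exists_blockOperator h n
    (((μ ^ (-(n : ℝ) / 2) : ℝ) : ℂ) • δ (coreGraded.toCore a))
  have hprod : ∀ k (x : coreGraded σ 𝒜 k), (a : A) * x ∈ coreGraded σ 𝒜 (n + k) := fun k x =>
    ⟨𝒜.mul_mem a.2.1 x.2.1, σ.mul_mem_spectralSubspace a.2.2 x.2.2⟩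
  have hcore : ∀ k (x : coreGraded σ 𝒜 k) (ξ : D₀.domain), S (simpleTensor σ ρ (x : A) ξ) =
      ((μ ^ (-(n : ℝ) / 2) : ℝ) : ℂ) •
        (((μ ^ (n + k) : ℝ) : ℂ) • horizontalVector ρ D₀ δ₀ (ζ (n + k)) ⟨_, hprod k x⟩ ξ) -
      ((μ ^ ((n : ℝ) / 2) : ℝ) : ℂ) • leftAction σ ρ a
        (((μ ^ k : ℝ) : ℂ) • horizontalVector ρ D₀ δ₀ (ζ k) x ξ) := by
    intro k x ξ
    rw [hS k _ (simpleTensor_mem_gradedPart σ ρ x.2.2 _), smul_apply,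
      ← hU.apply_commutator h hζ a x ⟨_, hprod k x⟩ rfl ξ]
    refine hU.adjoint_apply_self h (sub_mem ?_ ?_)
    · exact Submodule.smul_mem _ _ (Submodule.smul_mem _ _ (horizontalVector_mem _ _ _))
    · exact Submodule.smul_mem _ _ (leftAction_mem_gradedPart a.2.2
        (Submodule.smul_mem _ _ (horizontalVector_mem _ _ _)))
  refine ⟨S, ?_, fun k g hg => ⟨?_, ?_⟩⟩
  · rw [analyticAut_I_leftAction ρ h.exp.pos a.2.2, analyticAut_neg_I_leftAction ρ h.exp.pos a.2.2,
      extendsCommutator_iff]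
    let L : LiftedSpace σ ρ × LiftedSpace σ ρ →L[ℂ] LiftedSpace σ ρ × LiftedSpace σ ρ :=
      ((((μ ^ (-(n : ℝ) / 2) : ℝ) : ℂ) • leftAction σ ρ a) ∘L
        ContinuousLinearMap.fst ℂ _ _).prod
      (S ∘L ContinuousLinearMap.fst ℂ _ _ +
        (((μ ^ ((n : ℝ) / 2) : ℝ) : ℂ) • leftAction σ ρ a) ∘L ContinuousLinearMap.snd ℂ _ _)
    have h1 : (modularLift ρ D₀ δ₀ μ ζ).graph ≤
        (modularLift ρ D₀ δ₀ μ ζ).graph.comap L.toLinearMap := by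
      refine h.graph_le_of_core hζ
        ((h.isClosed_graph_modularLift hζ).preimage L.continuous) fun k x ξ => ?_
      have h2 := (modularLift ρ D₀ δ₀ μ ζ).graph.smul_mem ((μ ^ (-(n : ℝ) / 2) : ℝ) : ℂ)
        (h.core_mem_graph hζ ⟨_, hprod k x⟩ ξ)
      refine Eq.subst (motive := fun p => p ∈ (modularLift ρ D₀ δ₀ μ ζ).graph) ?_ h2
      refine Prod.ext ?_ ?_
      · change _ = ((μ ^ (-(n : ℝ) / 2) : ℝ) : ℂ) • leftAction σ ρ a (simpleTensor σ ρ (x : A) ξ)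
        rw [leftAction_simpleTensor]
        rfl
      · change _ = S (simpleTensor σ ρ (x : A) ξ) + ((μ ^ ((n : ℝ) / 2) : ℝ) : ℂ) •
          leftAction σ ρ a (((μ ^ k : ℝ) : ℂ) • horizontalVector ρ D₀ δ₀ (ζ k) x ξ)
        rw [hcore, sub_add_cancel]
        rfl
    exact fun y z hyz => h1 hyz
  · rw [hS k g hg]
    exact hU.adjoint_mem h _ _
  · refine h.eq_of_mem_gradedPart_core (S := U (n + k) ∘L S)
      (T := (((μ ^ (-(n : ℝ) / 2) : ℝ) : ℂ) • δ (coreGraded.toCore a)) ∘L U k)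
      (fun x hx ξ hξ => ?_) hg
    have h3 := hU.apply_commutator h hζ a ⟨x, hx⟩ ⟨_, hprod k ⟨x, hx⟩⟩ rfl ⟨ξ, hξ⟩
    rw [← hcore k ⟨x, hx⟩ ⟨ξ, hξ⟩] at h3
    exact h3

/-- The twisted derivation on all of `𝒜`, with its values on homogeneous elements. -/
theorem exists_twistedDerivation :
    ∃ δΓ : 𝒜 →ₗ[ℂ] (LiftedSpace σ ρ →L[ℂ] LiftedSpace σ ρ),
      (∀ a : 𝒜, ExtendsCommutator (modularLift ρ D₀ δ₀ μ ζ)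
        (analyticAut (modularGroup σ ρ μ) Complex.I (leftAction σ ρ a))
        (analyticAut (modularGroup σ ρ μ) (-Complex.I) (leftAction σ ρ a)) (δΓ a)) ∧
      ∀ (n k : ℤ) (a : 𝒜), (a : A) ∈ σ.spectralSubspace n → ∀ g ∈ gradedPart σ ρ k,
        δΓ a g ∈ gradedPart σ ρ (n + k) ∧
          U (n + k) (δΓ a g) = ((μ ^ (-(n : ℝ) / 2) : ℝ) : ℂ) • δ a (U k g) := by
  have hdense := h.dense_domain_modularLift hζ
  have han := fun (z : ℂ) (a : 𝒜) =>
    isAnalyticOperator_leftAction ρ (μ := μ) h.exp.generated z.im a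
  have hadd : ∀ (z : ℂ) (a b : 𝒜),
      analyticAut (modularGroup σ ρ μ) z (leftAction σ ρ ((a + b : 𝒜) : A)) =
        analyticAut (modularGroup σ ρ μ) z (leftAction σ ρ a) +
          analyticAut (modularGroup σ ρ μ) z (leftAction σ ρ b) := fun z a b => by
    rw [AddMemClass.coe_add, map_add, analyticAut_add (han z a) (han z b)]
  have hsmul : ∀ (z c : ℂ) (a : 𝒜),
      analyticAut (modularGroup σ ρ μ) z (leftAction σ ρ ((c • a : 𝒜) : A)) =
        c • analyticAut (modularGroup σ ρ μ) z (leftAction σ ρ a) := fun z c a => by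
    rw [← analyticAut_smul c (han z a), ← map_smul]; rfl
  have hex : ∀ a : 𝒜, ∃ S, ExtendsCommutator (modularLift ρ D₀ δ₀ μ ζ)
      (analyticAut (modularGroup σ ρ μ) Complex.I (leftAction σ ρ a))
      (analyticAut (modularGroup σ ρ μ) (-Complex.I) (leftAction σ ρ a)) S := by
    intro a
    induction a using homogeneous_induction h.exp.generated with
    | hom n a ha =>
      obtain ⟨S, hS, -⟩ := hU.exists_twistedDerivation_of_mem h hζ ⟨(a : A), a.2, ha⟩
      exact ⟨S, hS⟩
    | add a b ha hb =>
      obtain ⟨S, hS⟩ := ha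
      obtain ⟨S', hS'⟩ := hb
      exact ⟨S + S', by rw [hadd, hadd]; exact hS.add hS'⟩
  choose S hS using hex
  refine ⟨⟨⟨S, fun a b => ?_⟩, fun c a => ?_⟩, hS, fun n k a ha g hg => ?_⟩
  · refine (hS (a + b)).unique hdense ?_
    rw [hadd, hadd]
    exact (hS a).add (hS b)
  · refine (hS (c • a)).unique hdense ?_
    rw [hsmul, hsmul]
    exact (hS a).smul c
  · obtain ⟨S', hS', hval⟩ := hU.exists_twistedDerivation_of_mem h hζ ⟨(a : A), a.2, ha⟩
    change S a g ∈ _ ∧ U (n + k) (S a g) = _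
    rw [(hS a).unique hdense hS']
    exact hval k g hg

end IsTransport

/-! ### Gradings -/

theorem star_idTensor_mul (γ : H₀ →L[ℂ] H₀) (hγ : star γ * γ = 1) (hc : ∀ a, Commute γ (ρ a)) :
    star (idTensor σ ρ γ hγ hc) * idTensor σ ρ γ hγ hc = 1 := by
  have hin : ∀ g g', ⟪idTensor σ ρ γ hγ hc g, idTensor σ ρ γ hγ hc g'⟫_ℂ = ⟪g, g'⟫_ℂ := by
    intro g g'
    induction g, g' using UniformSpace.Completion.induction_on₂ with
    | hp => apply isClosed_eq <;> fun_prop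
    | ih x y =>
      obtain ⟨x, rfl⟩ := (toPre σ ρ).surjective x
      obtain ⟨y, rfl⟩ := (toPre σ ρ).surjective y
      simp only [idTensor, inducedOp_coe, UniformSpace.Completion.inner_coe, inner_toPre,
        form_lTensor σ ρ γ hγ hc]
  refine ContinuousLinearMap.ext fun g => ext_inner_left ℂ fun g' => ?_
  rw [mul_apply_eq_comp, ContinuousLinearMap.star_eq_adjoint,
    ContinuousLinearMap.adjoint_inner_right, hin]
  rfl

theorem StandingAssumptions.isGradingOperator (h : StandingAssumptions ρ D₀ δ₀ ι φ δ μ)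
    {m : ℤ → ℕ} {ζ : ∀ n, Fin (m n) → coreGraded σ 𝒜 n} (hζ : ∀ n, IsVanishingFrame φ δ (ζ n))
    {γ : H₀ →L[ℂ] H₀} (hγ : IsGradingOperator ρ (fun _ => 1) D₀ γ) :
    IsGradingOperator (leftAction σ ρ) (modularGroup σ ρ μ) (modularLift ρ D₀ δ₀ μ ζ)
      (idTensor σ ρ γ hγ.unitary hγ.comm_rep) := by
  set Γ := idTensor σ ρ γ hγ.unitary hγ.comm_rep with hΓ
  have hΓs : ∀ a ξ, Γ (simpleTensor σ ρ a ξ) = simpleTensor σ ρ a (γ ξ) :=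
    idTensor_simpleTensor σ ρ γ hγ.unitary hγ.comm_rep
  have h1 : star Γ * Γ = 1 := star_idTensor_mul γ hγ.unitary hγ.comm_rep
  have h2 : Γ * Γ = 1 := lifted_ext σ ρ fun a ξ => by
    have hγ2 : γ * γ = 1 := by
      have := hγ.unitary
      rwa [hγ.selfAdjoint] at this
    rw [mul_apply_eq_comp, hΓs, hΓs, ← mul_apply_eq_comp, hγ2]
    rfl
  refine ⟨left_inv_eq_right_inv h1 h2, h1, fun a => lifted_ext σ ρ fun b ξ => ?_,
    fun s => lifted_ext σ ρ fun b ξ => ?_, fun ξ => ?_⟩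
  · rw [mul_apply_eq_comp, mul_apply_eq_comp, leftAction_simpleTensor, hΓs, hΓs,
      leftAction_simpleTensor]
  · rw [mul_apply_eq_comp, mul_apply_eq_comp, modularGroup, circleUnitary_simpleTensor, hΓs, hΓs,
      circleUnitary_simpleTensor]
  · let L : LiftedSpace σ ρ × LiftedSpace σ ρ →L[ℂ] LiftedSpace σ ρ × LiftedSpace σ ρ :=
      (Γ ∘L ContinuousLinearMap.fst ℂ _ _).prod (-(Γ ∘L ContinuousLinearMap.snd ℂ _ _))
    have h3 : (modularLift ρ D₀ δ₀ μ ζ).graph ≤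
        (modularLift ρ D₀ δ₀ μ ζ).graph.comap L.toLinearMap := by
      refine h.graph_le_of_core hζ
        ((h.isClosed_graph_modularLift hζ).preimage L.continuous) fun n x ξ => ?_
      obtain ⟨hγξ, -⟩ := hγ.anticomm ξ
      refine Eq.subst (motive := fun p => p ∈ (modularLift ρ D₀ δ₀ μ ζ).graph) ?_
        (h.core_mem_graph hζ x ⟨γ ξ, hγξ⟩)
      refine Prod.ext (hΓs _ _).symm ?_
      change _ = -Γ (((μ ^ n : ℝ) : ℂ) • horizontalVector ρ D₀ δ₀ (ζ n) x ξ)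
      obtain ⟨hd, hsum⟩ := h.horizontalVector_eq_sum (hζ n) x ξ
      obtain ⟨hd', hsum'⟩ := h.horizontalVector_eq_sum (hζ n) x ⟨γ ξ, hγξ⟩
      rw [map_smul, ← smul_neg, hsum, map_sum, ← Finset.sum_neg_distrib]
      change ((μ ^ n : ℝ) : ℂ) • horizontalVector ρ D₀ δ₀ (ζ n) x ⟨γ ξ, hγξ⟩ = _
      rw [hsum']
      congr 1
      refine Finset.sum_congr rfl fun j _ => ?_
      obtain ⟨hd2, hanti⟩ := hγ.anticomm ⟨_, hd j⟩
      have hcomm : ρ (coreGraded.pairing (ζ n j) x) (γ ξ) =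
          γ (ρ (coreGraded.pairing (ζ n j) x) ξ) :=
        congrArg (fun T : H₀ →L[ℂ] H₀ => T ξ) (hγ.comm_rep _).eq.symm
      have hD : D₀ ⟨_, hd' j⟩ = -γ (D₀ ⟨_, hd j⟩) := by
        rw [← hanti]
        congr 1
        exact Subtype.ext hcomm
      rw [hD, hΓs, ← creation_apply, map_neg, creation_apply]
    obtain ⟨η, hη⟩ := (LinearPMap.mem_graph_iff _).mp (h3 (LinearPMap.mem_graph _ ξ))
    obtain ⟨h4, h5⟩ : (η : LiftedSpace σ ρ) = Γ ξ ∧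
      modularLift ρ D₀ δ₀ μ ζ η = -Γ (modularLift ρ D₀ δ₀ μ ζ ξ) := hη
    have hdom : Γ ξ ∈ (modularLift ρ D₀ δ₀ μ ζ).domain := h4 ▸ η.2
    obtain rfl : η = ⟨Γ ξ, hdom⟩ := Subtype.ext h4
    exact ⟨hdom, h5⟩

end Standing

end ModularLift

theorem theoremt {A : Type*} [CStarAlgebra A] (σ : CircleAction A) (𝒜 : StarSubalgebra ℂ A)
    (h𝒜 : Dense (𝒜 : Set A))
    {H₀ : Type*} [NormedAddCommGroup H₀] [InnerProductSpace ℂ H₀] [CompleteSpace H₀]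
    (ρ : σ.fixedAlgebra →⋆ₐ[ℂ] (H₀ →L[ℂ] H₀)) (D₀ : H₀ →ₗ.[ℂ] H₀)
    (δ₀ : coreFixed σ 𝒜 → (H₀ →L[ℂ] H₀))
    (hD₀ : IsLipschitzTriple (coreFixed σ 𝒜) ρ D₀ δ₀)
    {H : Type*} [NormedAddCommGroup H] [InnerProductSpace ℂ H] [CompleteSpace H]
    [TopologicalSpace.SeparableSpace H]
    (ι : H₀ →ₗᵢ[ℂ] H) (φ : A →⋆ₐ[ℂ] (H →L[ℂ] H)) (δ : 𝒜 →ₗ[ℂ] (H →L[ℂ] H)) (μ : ℝ)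
    (hexp : ExponentialAssumption ρ δ₀ ι φ δ μ) :
    -- frames as required in the construction of the modular lift exist
    (∀ n : ℤ, ∃ (k : ℕ) (ζ : Fin k → coreGraded σ 𝒜 n), IsVanishingFrame φ δ ζ) ∧
    -- the isometries `U_n : G_n → H`, `x ⊗ ξ ↦ φ(x) ξ`
    ∃ U : ∀ n : ℤ, gradedPart σ ρ n →ₗᵢ[ℂ] H,
      (∀ (n : ℤ) (x : A) (hx : x ∈ σ.spectralSubspace n) (ξ : H₀),
        U n ⟨simpleTensor σ ρ x ξ, simpleTensor_mem_gradedPart σ ρ hx ξ⟩ = φ x (ι ξ)) ∧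
      -- for every choice of frames, with `D_Γ` the corresponding modular lift
      ∀ (m : ℤ → ℕ) (ζ : ∀ n, Fin (m n) → coreGraded σ 𝒜 n),
        (∀ n, IsVanishingFrame φ δ (ζ n)) →
        -- the closure defining `D_Γ` is the graph of an operator
        (modularLift ρ D₀ δ₀ μ ζ).graph = modularLiftGraph ρ D₀ δ₀ μ ζ ∧
        IsTwistedLipschitzTriple 𝒜 (leftAction σ ρ) (modularLift ρ D₀ δ₀ μ ζ)
          (modularGroup σ ρ μ) ∧
        -- the associated twisted derivation `δ_Γ`
        (∃ δΓ : 𝒜 →ₗ[ℂ] (LiftedSpace σ ρ →L[ℂ] LiftedSpace σ ρ),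
          (∀ a : 𝒜, ExtendsCommutator (modularLift ρ D₀ δ₀ μ ζ)
            (analyticAut (modularGroup σ ρ μ) Complex.I (leftAction σ ρ a))
            (analyticAut (modularGroup σ ρ μ) (-Complex.I) (leftAction σ ρ a)) (δΓ a)) ∧
          (∀ a b : 𝒜, δΓ (a * b) =
            δΓ a * analyticAut (modularGroup σ ρ μ) Complex.I (leftAction σ ρ b) +
            analyticAut (modularGroup σ ρ μ) (-Complex.I) (leftAction σ ρ a) * δΓ b) ∧
          (∀ a : 𝒜, δΓ (star a) = -star (δΓ a)) ∧
          ∀ (n k : ℤ) (a : 𝒜), (a : A) ∈ σ.spectralSubspace n → ∀ η : gradedPart σ ρ k,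
            ∃ h : δΓ a η ∈ gradedPart σ ρ (n + k),
              U (n + k) ⟨δΓ a η, h⟩ = ((μ ^ (-(n : ℝ) / 2) : ℝ) : ℂ) • δ a (U k η)) ∧
        -- gradings
        ∀ (γ₀ : H₀ →L[ℂ] H₀) (hγ₀ : IsGradingOperator ρ (fun _ => 1) D₀ γ₀),
          IsGradingOperator (leftAction σ ρ) (modularGroup σ ρ μ) (modularLift ρ D₀ δ₀ μ ζ)
            (idTensor σ ρ γ₀ hγ₀.unitary hγ₀.comm_rep) := by
  have h : StandingAssumptions ρ D₀ δ₀ ι φ δ μ := ⟨h𝒜, hD₀, hexp⟩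
  obtain ⟨U, hU⟩ := h.exists_isTransport
  refine ⟨hexp.exists_vanishingFrame,
    fun n => ⟨(U n).toLinearMap ∘ₗ (gradedPart σ ρ n).subtype, fun g => hU.norm_apply h g.2⟩,
    hU.apply_simpleTensor, fun m ζ hζ => ?_⟩
  have hsa := h.isSelfAdjoint_modularLift hζ
  have hdense := h.dense_domain_modularLift hζ
  have hV := isUnitaryGroup_modularGroup σ ρ μ
  have han := isAnalyticOperator_leftAction ρ (μ := μ) hexp.generated
  obtain ⟨δΓ, hδ, hval⟩ := hU.exists_twistedDerivation h hζ
  refine ⟨h.graph_modularLift hζ, ?_, ⟨δΓ, hδ, fun a b => ?_, fun a => ?_, ?_⟩,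
    fun γ₀ hγ₀ => h.isGradingOperator hζ hγ₀⟩
  · refine ⟨h.separableSpace_lifted, h𝒜, leftAction_injective hD₀.injective, hsa, hV,
      fun a ha => ⟨han 1 ⟨a, ha⟩, ?_, ⟨_, hδ ⟨a, ha⟩⟩⟩⟩
    rw [← map_star]
    exact han 1 (star ⟨a, ha⟩)
  · refine (hδ (a * b)).unique hdense ?_
    rw [MulMemClass.coe_mul, map_mul, analyticAut_mul hV (han _ a) (han _ b),
      analyticAut_mul hV (han _ a) (han _ b)]
    exact (hδ a).mul (hδ b)
  · refine (hδ (star a)).unique hdense ?_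
    have h1 := (hδ a).star hsa
    have h2 := star_analyticAut_I ρ hexp.generated hexp.pos (star a)
    rw [star_eq_iff_star_eq] at h2
    have h3 : star (((star a : 𝒜) : A)) = a := star_star (a : A)
    rw [star_analyticAut_I ρ hexp.generated hexp.pos a] at h1
    rw [h3] at h2
    rw [h2] at h1
    exact h1
  · exact fun n k a ha η => ⟨(hval n k a ha η η.2).1, (hval n k a ha η η.2).2⟩
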